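/- **Definitions.** Let $T$ be a nonempty text of length $n$ over an arbitrary alphabet. A *period* of a string $w$ is a nonempty string $p$ with $w=p^{t}p'$, $t\ge 1$, $p'$ a prefix of $p$. A pattern $P$ is *periodic* if in some text it has three pairwise overlapping occurrences. A *period sequence* of $T$ is an interval $[s,e]$ of positions such that the shortest period $p$ of $T[s:e]$ is repeated more than twice, i.e. $2|p|<e-s+1$, and such that no larger interval of positions carries a substring with a period of length $|p|$. For a periodic pattern $P$, the *period sequences of $P$* are the period sequences $[s,e]$ of $T$ such that $T[s:e]$ starts with $P$ and the shortest period of $T[s:e]$ is the shortest period of $P$. Consider the suffix tree of $T\$$, where $\$$ is an end marker not in the alphabet. A node *represents* a string $X$ if the search for $X$ from the root ends at it, i.e. if it is the highest node whose label starts with $X$. For every string $p$ that is the shortest period of some periodic pattern occurring in $T$ there is one *period path*, with period $p$; it consists of all nodes that represent some string $P$ which has the period $p$ and satisfies $|P|>2|p|$. A period sequence $[s,e]$ *belongs* to this path if $p$ is a period of $T[s:e]$ and $2|p|<e-s+1$. The *period-path data structure* of $T$ consists of: the text $T\$$; the suffix tree, each node storing the position and length of an occurrence of its label and a dictionary of its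 children, indexed by the first letters of the edges; for each period path, the list of the period sequences belonging to it, in order of nondecreasing length; and, at each node $v$ and for each period path (with period $p$, say) on which $v$ lies, a record holding $|p|$, the largest length $\ell$ of a string of that path represented by $v$, and a pointer to the first period sequence of length at least $\ell$ in the list of that path. The records of a node are sorted by $|p|$. Space is measured in words: each stored letter and each stored number (including the sizes of all tables) takes one word. In a query, comparing a letter with the text, looking up a letter in the dictionary of a node, inspecting one record, and reporting one element of a list cost one step each. A query for $P$ searches for $P$ from the root, scans the records of the node reached for the period path of $P$, follows the pointer, and reports the rest of the list. **Theorem.** There is an absolute constant $C$ such that for every nonempty text $T$ of length $n$ over any alphabet: 1. each period sequence of $T$ belongs to exactly one period path; 2. $T$ has at most $Cn$ period sequences; 3. the period-path data structure of $T$ exists, it takes at most $Cn$ words of space, and every stored number is at most $Cn$ (so that a word has $\log n+O(1)$ bits); 4. for every periodic pattern $P$ of length $m$, a query to this data structure reports exactly the period sequences of $P$, each once, in at most $C(m+occ_{NO})$ steps, where $occ_{NO}$ is the maximum number of pairwise non-overlapping occurrences of $P$ in $T$. -/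

import Mathlib

namespace PeriodPaths

/-! ### Words, periods, occurrences

Words are lists; positions are counted from `0`. -/

section Words

variable {α : Type*}

/-- `slice T s e` is the substring `T[s : e]`, both end positions included. -/
def slice (T : List α) (s e : ℕ) : List α := (T.drop s).take (e + 1 - s)

/-- `P` occurs in `T` at position `i`. -/
def OccursAt (P T : List α) (i : ℕ) : Prop := i ≤ T.length ∧ P <+: T.drop i

/-- `p` is a period of `w`: `w = p ^ t ++ p'` with `t ≥ 1` and `p'` a prefix of `p`. -/
def IsPeriodOf (p w : List α) : Prop :=
  ∃ t : ℕ, 1 ≤ t ∧ ∃ p' : List α, p' <+: p ∧ w = (List.replicate t p).flatten ++ p'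

/-- `p` is the shortest nonempty period of `w`. -/
def IsShortestPeriod (p w : List α) : Prop :=
  p ≠ [] ∧ IsPeriodOf p w ∧ ∀ q : List α, q ≠ [] → IsPeriodOf q w → p.length ≤ q.length

/-- A periodic pattern can appear more than twice overlapping: in some text it has three
occurrences `i < j < k` any two of which overlap (the last one starts before the first one ends). -/
def IsPeriodic (P : List α) : Prop :=
  ∃ (W : List α) (i j k : ℕ), i < j ∧ j < k ∧ k < i + P.length ∧
    OccursAt P W i ∧ OccursAt P W j ∧ OccursAt P W k

open Classical in
/-- The maximum number of pairwise non-overlapping occurrences of `P` in `T`. -/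
noncomputable def occNO (T P : List α) : ℕ :=
  ((Finset.range (T.length + 1)).powerset.filter fun S =>
    (∀ i ∈ S, OccursAt P T i) ∧ ∀ i ∈ S, ∀ j ∈ S, i < j → i + P.length ≤ j).sup Finset.card

/-- `[s, e]` is a period sequence of `T` with period `p`: a substring in which its (shortest)
period `p` is repeated more than twice, and which is maximal, i.e. no larger interval of positions
of `T` carries a substring with a period of the same length. -/
def IsPeriodSequenceWith (T p : List α) (s e : ℕ) : Prop :=
  s ≤ e ∧ e < T.length ∧ IsShortestPeriod p (slice T s e) ∧ 2 * p.length < e + 1 - s ∧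
    ∀ s' e' : ℕ, s' ≤ s → e ≤ e' → e' < T.length →
      (∃ p' : List α, p'.length = p.length ∧ IsPeriodOf p' (slice T s' e')) → s' = s ∧ e' = e

/-- `[s, e]` is a period sequence of `T`. -/
def IsPeriodSequence (T : List α) (s e : ℕ) : Prop := ∃ p, IsPeriodSequenceWith T p s e

/-- `[s, e]` is a period sequence of the periodic pattern `P`: a period sequence of the text
for the period of `P` which starts with `P`. -/
def IsPeriodSequenceOf (T P : List α) (s e : ℕ) : Prop :=
  ∃ p, IsShortestPeriod p P ∧ IsPeriodSequenceWith T p s e ∧ P <+: slice T s e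

end Words

/-! ### The suffix tree and its period paths -/

section SuffixTree

variable {α : Type*}

/-- The text followed by an end marker (`none`) which occurs nowhere else. -/
def terminated (T : List α) : List (Option α) := T.map some ++ [none]

/-- `w` is the label of a node of the suffix tree (compacted trie of all suffixes) of the
terminated text: the root, a leaf (a nonempty suffix), or a branching node. -/
def IsTreeNode (T : List α) (w : List (Option α)) : Prop :=
  w = [] ∨ (w ≠ [] ∧ w <:+ terminated T) ∨
    ∃ c c' : Option α, c ≠ c' ∧ w ++ [c] <:+: terminated T ∧ w ++ [c'] <:+: terminated T

/-- `w` is the label of the node at which the search for `X` ends: the highest node whose label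
starts with `X`. The node represents all the strings `X` whose search ends at it. -/
def IsLocus (T : List α) (X w : List (Option α)) : Prop :=
  IsTreeNode T w ∧ X <+: w ∧ ∀ w', IsTreeNode T w' → X <+: w' → w.length ≤ w'.length

/-- `P` consists of more than two repetitions of the period `p`. -/
def Continues (p P : List α) : Prop := p ≠ [] ∧ IsPeriodOf p P ∧ 2 * p.length < P.length

/-- `p` is the period of a period path: some periodic pattern which occurs in `T` (hence is
represented by a node of the suffix tree) has shortest period `p`. There is one period path
for each such `p`. -/
def IsPathPeriod (T p : List α) : Prop :=
  ∃ P : List α, P <:+: T ∧ IsPeriodic P ∧ IsShortestPeriod p P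

/-- The nodes (labels) of the period path with period `p`: all the nodes of the suffix tree which
represent a string that continues `p`. -/
def periodPath (T p : List α) : Set (List (Option α)) :=
  {w | ∃ P : List α, Continues p P ∧ IsLocus T (P.map some) w}

/-- The interval `[s, e]` of the text belongs to the period path with period `p`. -/
def BelongsToPath (T p : List α) (s e : ℕ) : Prop :=
  IsPathPeriod T p ∧ Continues p (slice T s e)

end SuffixTree

/-! ### The data structure -/

/-- A pointer from a node to the list of a period path on which the node lies. -/
structure PathPtr where
  /-- the length of the period of the path -/
  period : ℕ
  /-- the greatest length of a string of that path which the node represents -/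
  last : ℕ
  /-- the index of the list of the path -/
  list : ℕ
  /-- the position in that list -/
  offset : ℕ

/-- A node of the stored suffix tree; its label is `text[start], …, text[start + depth - 1]`. -/
structure TreeNode (α : Type*) where
  start : ℕ
  depth : ℕ
  /-- the dictionary of the children: first letter of the edge, index of the child -/
  children : List (Option α × ℕ)
  paths : List PathPtr

/-- The contents of the memory: the text, the nodes of the suffix tree, and one list of period
sequences for each period path. -/
structure PeriodIndex (α : Type*) where
  text : List (Option α)
  nodes : List (TreeNode α)
  lists : List (List (ℕ × ℕ))

namespace PeriodIndex

variable {α : Type*}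

/-- The label of a node. -/
def label (M : PeriodIndex α) (v : TreeNode α) : List (Option α) :=
  (M.text.drop v.start).take v.depth

/-- All the letters which are stored. -/
def letters (M : PeriodIndex α) : List (Option α) :=
  M.text ++ M.nodes.flatMap fun v => v.children.map Prod.fst

/-- All the numbers which are stored, including the sizes of all the tables and lists. -/
def numbers (M : PeriodIndex α) : List ℕ :=
  [M.text.length, M.nodes.length, M.lists.length] ++
  (M.nodes.flatMap fun v =>
    [v.start, v.depth, v.children.length, v.paths.length] ++ v.children.map Prod.snd ++
      v.paths.flatMap fun r => [r.period, r.last, r.list, r.offset]) ++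
  M.lists.flatMap fun L => L.length :: L.flatMap fun x => [x.1, x.2]

/-- The space in words: every letter and every number takes one word. -/
def space (M : PeriodIndex α) : ℕ := M.letters.length + M.numbers.length

/-- The search for a pattern below the node `v`, after `d` letters have been matched. It returns
the node at which the search ends (`none` if it fails), and the number of steps; comparing one
letter with the text, or looking up one letter in the dictionary of a node, takes one step. -/
def walk [DecidableEq α] (M : PeriodIndex α) :
    TreeNode α → ℕ → List α → Option (TreeNode α) × ℕ
  | v, _, [] => (some v, 1)
  | v, d, c :: P =>
    if d < v.depth then
      if M.text[v.start + d]? = some (some c) then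
        ((walk M v (d + 1) P).1, (walk M v (d + 1) P).2 + 1)
      else (none, 1)
    else
      match (v.children.lookup (some c)).bind (fun i => M.nodes[i]?) with
      | some u => ((walk M u (d + 1) P).1, (walk M u (d + 1) P).2 + 1)
      | none => (none, 1)

/-- The scan of the pointers of a node for the period path of a pattern of length `m`,
one step for each pointer which is inspected. -/
def findPath (m : ℕ) : List PathPtr → Option PathPtr × ℕ
  | [] => (none, 1)
  | r :: rs =>
    if m ≤ 2 * r.period then (none, 1)
    else if m ≤ r.last then (some r, 1)
    else ((findPath m rs).1, (findPath m rs).2 + 1)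

/-- Reporting the elements of a list, one step for each of them. -/
def report : List (ℕ × ℕ) → List (ℕ × ℕ) × ℕ
  | [] => ([], 1)
  | x :: L => (x :: (report L).1, (report L).2 + 1)

/-- The query for a periodic pattern: the reported intervals and the number of steps. Search the
pattern from the root (node `0`), select the period path, follow the pointer into its list, and
report the list from there on. -/
def query [DecidableEq α] (M : PeriodIndex α) (P : List α) : List (ℕ × ℕ) × ℕ :=
  match M.nodes[0]? with
  | none => ([], 1)
  | some root =>
    match M.walk root 0 P with
    | (none, t₁) => ([], t₁)
    | (some v, t₁) =>
      match findPath P.length v.paths with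
      | (none, t₂) => ([], t₁ + t₂)
      | (some r, t₂) =>
        ((report ((M.lists.getD r.list []).drop r.offset)).1,
          t₁ + t₂ + (report ((M.lists.getD r.list []).drop r.offset)).2)

end PeriodIndex

/-- `M` is the period-path data structure of the text `T`, where `M.lists[i]` is the list of the
period path with period `periods[i]`. -/
structure IsPeriodIndexWith {α : Type*} (T : List α) (M : PeriodIndex α)
    (periods : List (List α)) : Prop where
  text_eq : M.text = terminated T
  -- the nodes are the nodes of the suffix tree, the root first
  root : M.nodes[0]?.map M.label = some []
  nodes_nodup : (M.nodes.map M.label).Nodup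
  mem_nodes : ∀ w, w ∈ M.nodes.map M.label ↔ IsTreeNode T w
  start_add_depth : ∀ v ∈ M.nodes, v.start + v.depth ≤ M.text.length
  -- the children of a node
  keys_nodup : ∀ v ∈ M.nodes, (v.children.map Prod.fst).Nodup
  mem_children : ∀ v ∈ M.nodes, ∀ (c : Option α) (i : ℕ), (c, i) ∈ v.children ↔
    ∃ u, M.nodes[i]? = some u ∧ IsLocus T (M.label v ++ [c]) (M.label u)
  -- one list for each period path, holding its period sequences sorted by their length
  periods_nodup : periods.Nodup
  mem_periods : ∀ p, p ∈ periods ↔ IsPathPeriod T p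
  length_lists : M.lists.length = periods.length
  lists_nodup : ∀ L ∈ M.lists, L.Nodup
  lists_sorted : ∀ L ∈ M.lists, L.Pairwise fun x y => x.2 + 1 - x.1 ≤ y.2 + 1 - y.1
  mem_lists : ∀ (i : ℕ) (p : List α) (L : List (ℕ × ℕ)),
    periods[i]? = some p → M.lists[i]? = some L →
      ∀ s e, (s, e) ∈ L ↔ IsPeriodSequence T s e ∧ BelongsToPath T p s e
  -- one pointer from each node for each period path on which it lies, to the first period
  -- sequence of the path which is not shorter than the strings of the path at that node
  paths_sorted : ∀ v ∈ M.nodes, v.paths.Pairwise fun r r' => r.period < r'.period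
  mem_paths : ∀ v ∈ M.nodes, ∀ r : PathPtr, r ∈ v.paths ↔
    ∃ p L, periods[r.list]? = some p ∧ M.lists[r.list]? = some L ∧
      M.label v ∈ periodPath T p ∧
      r.period = p.length ∧
      IsGreatest {m | ∃ P : List α, P.length = m ∧ Continues p P ∧
        IsLocus T (P.map some) (M.label v)} r.last ∧
      r.offset = L.countP fun x => decide (x.2 + 1 - x.1 < r.last)

/-- `M` is the period-path data structure of the text `T`. -/
def IsPeriodIndex {α : Type*} (T : List α) (M : PeriodIndex α) : Prop :=
  ∃ periods : List (List α), IsPeriodIndexWith T M periods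

end PeriodPaths

open PeriodPaths

/-! A word that continues a primitive `p` has length above `2 * p.length`, so by Fine and Wilf `p`
is its only primitive period with this property (`IsPrimitive.eq_of_continues`). Periodic patterns
are exactly the words that continue some `p`; hence period sequences and periodic patterns have
well-defined paths.

Period sequences are the runs of `T`, and there are at most `n` of them by the Lyndon-root argument:
the letter that breaks a run on the right selects an order or its dual, a minimal rotation of the
period then starts at a position determined by suffix comparisons in that order, and two different
runs cannot share such a position (`IsRun.eq_of_isAnchor`). There are at most `2n` path periods,
because three primitive squares cannot all have their last occurrence at one position
(`false_of_three_squares`).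

A node carries at most one record whose path contains its entire label, since the label then
determines the period. A path has at most one other node, the one where it leaves the tree in the
middle of an edge (`node_eq_of_not_full`). So the number of records is at most nodes plus paths,
which makes the space linear.

For a query, every occurrence of `P` extends to an occurrence of the label of its node. By
maximality, a period sequence starting with `P` therefore has length at least `last`, so the pointer
of the node is right for all patterns of the path ending there (`mem_list_iff`). Starts of two
period sequences of `P` differ by more than `P.length / 2`, so every other one gives non-overlapping
occurrences (`length_le_two_mul_occNO`). The scan of the records costs at most `p.length + 1` steps
since their periods strictly increase (`findPath_eq`). -/

namespace PeriodPaths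
-- Periods, primitivity and periodic patterns
section Words
variable {α : Type*}

theorem hasPeriod_iff {w : List α} {q : ℕ} :
    w.HasPeriod q ↔ ∀ x, x + q < w.length → w[x]? = w[x + q]? := by
  rw [List.hasPeriod_iff_getElem?]
  exact ⟨fun h x hx => h x (by omega), fun h x hx => h x (by omega)⟩

/-- Reduce an index first modulo `p.length`, then modulo `d`; divisibility makes the two reductions
agree with a single one modulo `d`. -/
theorem hasPeriod_of_prefix_of_dvd {p w : List α} {d : ℕ} (hne : p ≠ []) (hpw : p <+: w)
    (hw : w.HasPeriod p.length) (hp : p.HasPeriod d) (hd : d ∣ p.length) : w.HasPeriod d := by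
  rw [List.hasPeriod_iff_forall_getElem?_mod] at hw hp ⊢
  have hpos : 0 < p.length := List.length_pos_of_ne_nil hne
  have hget : ∀ x, x < p.length → w[x]? = p[x]? := fun x hx => by
    rw [List.prefix_iff_getElem?.1 hpw x hx, List.getElem?_eq_getElem hx]
  intro i hi
  have hm := Nat.mod_lt i hpos
  have hle := hpw.length_le
  rw [hw i hi, hget _ hm, hp _ hm, Nat.mod_mod_of_dvd _ hd, hget]
  exact (Nat.mod_lt _ (Nat.pos_of_dvd_of_pos hd hpos)).trans_le (Nat.le_of_dvd hpos hd)

/-- Trades the power form of a period for an index condition, to which the Fine–Wilf theorem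
`List.HasPeriod.gcd` applies. The converse peels off one copy of `p` at a time. -/
theorem isPeriodOf_iff {p w : List α} (hp : p ≠ []) :
    IsPeriodOf p w ↔ p <+: w ∧ w.HasPeriod p.length := by
  constructor
  · rintro ⟨t, ht, p', hp', rfl⟩
    obtain ⟨t, rfl⟩ : ∃ s, t = s + 1 := ⟨t - 1, by omega⟩
    have h1 : (List.replicate (t + 1) p).flatten ++ p' = p ++ ((List.replicate t p).flatten ++ p') := by
      simp [List.replicate_succ]
    refine ⟨h1 ▸ List.prefix_append _ _, ?_⟩
    have h2 : (List.replicate (t + 1) p).flatten = (List.replicate t p).flatten ++ p := by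
      simp [List.replicate_succ']
    unfold List.HasPeriod
    have h3 : List.take p.length ((List.replicate (t + 1) p).flatten ++ p') = p := by
      rw [h1]; simp
    rw [h3]
    nth_rw 1 [h1]
    rw [List.prefix_append_right_inj, h2, List.append_assoc, List.prefix_append_right_inj]
    exact hp'.trans (List.prefix_append _ _)
  · rintro ⟨hpw, hw⟩
    induction hn : w.length using Nat.strong_induction_on generalizing w with
    | _ n ih =>
    obtain ⟨v, rfl⟩ := hpw
    have hv : v <+: p ++ v := by
      unfold List.HasPeriod at hw
      rw [List.take_left, List.prefix_append_right_inj] at hw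
      exact hw
    have hpos : 0 < p.length := List.length_pos_of_ne_nil hp
    rcases le_total v.length p.length with h | h
    · exact ⟨1, le_refl _, v, List.prefix_of_prefix_length_le hv (List.prefix_append _ _) h,
        by simp⟩
    · have hpv : p <+: v := List.prefix_of_prefix_length_le (List.prefix_append _ _) hv h
      have hper : v.HasPeriod p.length := hw.infix (List.suffix_append p v).isInfix
      obtain ⟨t, ht, p', hp', he⟩ := ih v.length (by simp at hn; omega) hpv hper rfl
      refine ⟨t + 1, by omega, p', hp', ?_⟩
      rw [he]; simp [List.replicate_succ]

/-- `p` is not a proper power. -/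
def IsPrimitive (p : List α) : Prop :=
  p ≠ [] ∧ ∀ d, 0 < d → d ∣ p.length → p.HasPeriod d → d = p.length

theorem continues_iff {p w : List α} :
    Continues p w ↔ p ≠ [] ∧ p <+: w ∧ w.HasPeriod p.length ∧ 2 * p.length < w.length := by
  unfold Continues
  constructor
  · rintro ⟨h, h1, h2⟩
    rw [isPeriodOf_iff h] at h1
    exact ⟨h, h1.1, h1.2, h2⟩
  · rintro ⟨h, h1, h2, h3⟩
    exact ⟨h, (isPeriodOf_iff h).2 ⟨h1, h2⟩, h3⟩

theorem IsShortestPeriod.isPrimitive {p w : List α} (h : IsShortestPeriod p w) :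
    IsPrimitive p := by
  obtain ⟨hp, hper, hmin⟩ := h
  rw [isPeriodOf_iff hp] at hper
  refine ⟨hp, fun d hd hdvd hpd => ?_⟩
  have hpos : 0 < p.length := List.length_pos_of_ne_nil hp
  have hle := Nat.le_of_dvd hpos hdvd
  have hq : p.take d ≠ [] := by simp; exact ⟨by omega, hp⟩
  have hlen : (p.take d).length = d := by simp [hle]
  have := hmin (p.take d) hq ((isPeriodOf_iff hq).2
    ⟨(List.take_prefix _ _).trans hper.1, by
      rw [hlen]; exact hasPeriod_of_prefix_of_dvd hp hper.1 hper.2 hpd hdvd⟩)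
  omega

/-- Since `p.length + d ≤ 2 * p.length + 1 ≤ w.length`, Fine and Wilf give `w`, hence its prefix
`p`, the period `gcd p.length d`. Primitivity forces this gcd to be `p.length`. -/
theorem IsPrimitive.length_dvd {p w : List α} (hp : IsPrimitive p) (hpw : Continues p w)
    {d : ℕ} (hd : 0 < d) (hdw : w.HasPeriod d) (hlen : d ≤ p.length + 1) : p.length ∣ d := by
  rw [continues_iff] at hpw
  obtain ⟨h0, h1, h2, h3⟩ := hpw
  have hg : w.HasPeriod (p.length.gcd d) := h2.gcd hdw (by
    have := Nat.gcd_pos_of_pos_right p.length hd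
    omega)
  have := hp.2 _ (Nat.gcd_pos_of_pos_right _ hd) (Nat.gcd_dvd_left _ _) (hg.infix h1.isInfix)
  rw [← this]; exact Nat.gcd_dvd_right _ _

theorem IsPrimitive.eq_of_continues {p q w : List α} (hp : IsPrimitive p) (hq : IsPrimitive q)
    (hpw : Continues p w) (hqw : Continues q w) : p = q := by
  have hp' := continues_iff.1 hpw
  have hq' := continues_iff.1 hqw
  have h1 : 0 < p.length := List.length_pos_of_ne_nil hp.1
  have h2 : 0 < q.length := List.length_pos_of_ne_nil hq.1
  have hlen : p.length = q.length := by
    rcases le_total p.length q.length with h | h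
    · have := Nat.le_of_dvd h1 (hq.length_dvd hqw h1 hp'.2.2.1 (by omega)); omega
    · have := Nat.le_of_dvd h2 (hp.length_dvd hpw h2 hq'.2.2.1 (by omega)); omega
  exact (List.prefix_of_prefix_length_le hp'.2.1 hq'.2.1 hlen.le).eq_of_length hlen

theorem IsPrimitive.isShortestPeriod {p w : List α} (hp : IsPrimitive p) (hpw : Continues p w) :
    IsShortestPeriod p w := by
  refine ⟨hp.1, hpw.2.1, fun q hq hqw => ?_⟩
  by_contra hcon
  have h2 : 0 < q.length := List.length_pos_of_ne_nil hq
  have := Nat.le_of_dvd h2 (hp.length_dvd hpw h2 ((isPeriodOf_iff hq).1 hqw).2 (by omega))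
  omega

theorem IsShortestPeriod.eq {p q w : List α} (hp : IsShortestPeriod p w)
    (hq : IsShortestPeriod q w) : p = q := by
  have hlen : p.length = q.length :=
    le_antisymm (hp.2.2 q hq.1 hq.2.1) (hq.2.2 p hp.1 hp.2.1)
  exact (List.prefix_of_prefix_length_le ((isPeriodOf_iff hp.1).1 hp.2.1).1
    ((isPeriodOf_iff hq.1).1 hq.2.1).1 hlen.le).eq_of_length hlen

theorem exists_isShortestPeriod {w : List α} (hw : w ≠ []) : ∃ p, IsShortestPeriod p w := by
  classical
  have hex : ∃ k, ∃ p : List α, p ≠ [] ∧ IsPeriodOf p w ∧ p.length = k :=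
    ⟨_, w, hw, (isPeriodOf_iff hw).2 ⟨List.prefix_refl _, by simp⟩, rfl⟩
  obtain ⟨p, hp, hper, hl⟩ := Nat.find_spec hex
  exact ⟨p, hp, hper, fun q hq hqw => hl ▸ Nat.find_min' hex ⟨q, hq, hqw, rfl⟩⟩

theorem OccursAt.getElem? {P T : List α} {i x : ℕ} (h : OccursAt P T i) (hx : x < P.length) :
    T[i + x]? = P[x]? := by
  rw [← List.getElem?_drop, List.prefix_iff_getElem?.1 h.2 x hx, List.getElem?_eq_getElem hx]

theorem occursAt_of_getElem? {P T : List α} {i : ℕ} (hi : i + P.length ≤ T.length)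
    (h : ∀ x, x < P.length → T[i + x]? = P[x]?) : OccursAt P T i := by
  refine ⟨by omega, ?_⟩
  rw [List.prefix_iff_getElem?]
  intro x hx
  rw [List.getElem?_drop, h x hx, List.getElem?_eq_getElem hx]

theorem OccursAt.add_length_le {P T : List α} {i : ℕ} (h : OccursAt P T i) :
    i + P.length ≤ T.length := by
  have := h.2.length_le
  have := h.1
  simp at *; omega

theorem hasPeriod_of_occursAt {P T : List α} {i j : ℕ} (hi : OccursAt P T i)
    (hj : OccursAt P T j) (hij : i ≤ j) : P.HasPeriod (j - i) := by
  rw [hasPeriod_iff]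
  intro x hx
  rw [← hi.getElem? hx, ← hj.getElem? (x := x) (by omega)]
  congr 1; omega

theorem isInfix_iff_occursAt {P T : List α} : P <:+: T ↔ ∃ i, OccursAt P T i := by
  constructor
  · rintro ⟨s, t, rfl⟩
    refine ⟨s.length, by simp, ?_⟩
    rw [List.append_assoc, List.drop_left]
    exact List.prefix_append _ _
  · rintro ⟨i, -, h⟩
    exact h.isInfix.trans (List.drop_suffix _ _).isInfix

/-- Both gaps between the three occurrences are periods of `P`, so each is at least the shortest
one, and their sum is less than `P.length`. -/
theorem IsPeriodic.exists_continues {P : List α} (h : IsPeriodic P) :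
    ∃ p, IsShortestPeriod p P ∧ Continues p P := by
  obtain ⟨W, i, j, k, hij, hjk, hk, hi, hj, hk'⟩ := h
  obtain ⟨p, hp⟩ := exists_isShortestPeriod (w := P) (by rintro rfl; simp at hk; omega)
  refine ⟨p, hp, hp.1, hp.2.1, ?_⟩
  have key : ∀ d, 0 < d → d ≤ P.length → P.HasPeriod d → p.length ≤ d := by
    intro d hd hdl hper
    have hlen : (P.take d).length = d := by simp [hdl]
    have hne : P.take d ≠ [] := List.ne_nil_of_length_pos (by omega)
    have := hp.2.2 (P.take d) hne ((isPeriodOf_iff hne).2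
      ⟨List.take_prefix _ _, by rwa [hlen]⟩)
    omega
  have h1 := key (j - i) (by omega) (by omega) (hasPeriod_of_occursAt hi hj hij.le)
  have h2 := key (k - j) (by omega) (by omega) (hasPeriod_of_occursAt hj hk' hjk.le)
  omega

theorem Continues.isPeriodic {p P : List α} (h : Continues p P) : IsPeriodic P := by
  rw [continues_iff] at h
  obtain ⟨hp, hpP, hper, hlen⟩ := h
  have hpos : 0 < p.length := List.length_pos_of_ne_nil hp
  have htake : P.take p.length = p := (List.prefix_iff_eq_take.1 hpP).symm
  have h1 : P <+: p ++ P := by have := hper; unfold List.HasPeriod at this; rwa [htake] at this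
  refine ⟨p ++ (p ++ P), 0, p.length, p.length + p.length, hpos, by omega, by omega,
    ⟨by simp, ?_⟩, ⟨by simp, ?_⟩, ⟨by simp, ?_⟩⟩
  · simpa using h1.trans ((List.prefix_append_right_inj p).2 h1)
  · simpa using h1
  · rw [← List.drop_drop]; simp

theorem IsPathPeriod.isPrimitive {T p : List α} (h : IsPathPeriod T p) : IsPrimitive p :=
  let ⟨_, _, _, h⟩ := h; h.isPrimitive

theorem isPathPeriod_iff {T p : List α} :
    IsPathPeriod T p ↔ IsPrimitive p ∧ ∃ P, P <:+: T ∧ Continues p P := by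
  constructor
  · rintro ⟨P, hPT, hper, hp⟩
    obtain ⟨q, hq, hqc⟩ := hper.exists_continues
    obtain rfl := hp.eq hq
    exact ⟨hp.isPrimitive, P, hPT, hqc⟩
  · rintro ⟨hp, P, hPT, hc⟩
    exact ⟨P, hPT, hc.isPeriodic, hp.isShortestPeriod hc⟩

theorem Continues.take {p P : List α} (h : Continues p P) {k : ℕ} (hk : 2 * p.length < k) :
    Continues p (P.take k) := by
  rw [continues_iff] at *
  obtain ⟨h0, h1, h2, h3⟩ := h
  refine ⟨h0, ?_, h2.infix (List.take_prefix _ _).isInfix, by simp; omega⟩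
  rw [List.prefix_take_iff]
  exact ⟨h1, by omega⟩

theorem Continues.of_prefix {p P Q : List α} (h : Continues p P) (hQ : Q <+: P)
    (hk : 2 * p.length < Q.length) : Continues p Q := by
  rw [List.prefix_iff_eq_take.1 hQ]; exact h.take hk

/-- Two words with the same period are comparable. -/
theorem Continues.prefix_of_length_le {p P Q : List α} (hP : Continues p P) (hQ : Continues p Q)
    (h : P.length ≤ Q.length) : P <+: Q := by
  rw [continues_iff] at *
  obtain ⟨h0, h1, h2, h3⟩ := hP
  obtain ⟨-, h1', h2', h3'⟩ := hQ
  have hpos : 0 < p.length := List.length_pos_of_ne_nil h0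
  rw [List.hasPeriod_iff_forall_getElem?_mod] at h2 h2'
  rw [List.prefix_iff_getElem?]
  intro i hi
  have hm := Nat.mod_lt i hpos
  rw [← List.getElem?_eq_getElem hi, h2' i (by omega), h2 i hi,
    List.prefix_iff_getElem?.1 h1 _ hm, List.prefix_iff_getElem?.1 h1' _ hm]

end Words

/-! ### Counting period sequences by Lyndon roots -/

section Runs

/-- The suffix of the infinite word `t` which starts at `a`, with the lexicographic order. -/
def suffixAt {β : Type*} (t : ℕ → β) (a : ℕ) : Lex (ℕ → β) := toLex fun h => t (a + h)

theorem suffixAt_lt_iff {β : Type*} [LinearOrder β] {t : ℕ → β} {a b : ℕ} :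
    suffixAt t a < suffixAt t b ↔
      ∃ h, (∀ j < h, t (a + j) = t (b + j)) ∧ t (a + h) < t (b + h) := Iff.rfl

theorem suffixAt_orderDual_lt_iff {β : Type*} [LinearOrder β] {t : ℕ → β} {a b : ℕ} :
    suffixAt (β := βᵒᵈ) t a < suffixAt (β := βᵒᵈ) t b ↔ suffixAt t b < suffixAt t a := by
  constructor
  · rintro ⟨h, h1, h2⟩
    exact ⟨h, fun j hj => (h1 j hj).symm, h2⟩
  · rintro ⟨h, h1, h2⟩
    exact ⟨h, fun j hj => (h1 j hj).symm, h2⟩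

theorem suffixAt_succ_lt {β : Type*} [LinearOrder β] {t : ℕ → β} {a b : ℕ}
    (h : suffixAt t a < suffixAt t b) (hab : t a = t b) :
    suffixAt t (a + 1) < suffixAt t (b + 1) := by
  obtain ⟨h, h1, h2⟩ := h
  rcases h with _ | h
  · exact absurd (show t a < t b from h2) (by simp [hab])
  · refine ⟨h, fun j hj => ?_, ?_⟩
    · have := h1 (j + 1) (Nat.succ_lt_succ hj)
      change t (a + (j + 1)) = t (b + (j + 1)) at this
      change t (a + 1 + j) = t (b + 1 + j)
      rwa [add_assoc, add_assoc, add_comm 1]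
    · change t (a + (h + 1)) < t (b + (h + 1)) at h2
      change t (a + 1 + h) < t (b + 1 + h)
      rwa [add_assoc, add_assoc, add_comm 1]

/-- The first position after `k` at which a smaller suffix than that of `k` starts is `k + p`. -/
def NextSmaller {β : Type*} [LinearOrder β] (t : ℕ → β) (k p : ℕ) : Prop :=
  suffixAt t (k + p) < suffixAt t k ∧ ∀ d, 0 < d → d < p → suffixAt t k < suffixAt t (k + d)

theorem NextSmaller.eq {β : Type*} [LinearOrder β] {t : ℕ → β} {k p q : ℕ}
    (hp : NextSmaller t k p) (hq : NextSmaller t k q) (hp0 : 0 < p) (hq0 : 0 < q) : p = q := by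
  by_contra hne
  rcases lt_or_gt_of_ne hne with h | h
  · exact lt_asymm hp.1 (hq.2 p hp0 h)
  · exact lt_asymm hq.1 (hp.2 q hq0 h)

/-- In the original order the suffix at `k + q + 1` is smaller than that at `k`. Deleting their
common first letter puts the suffix at `k + q + 2` below that at `k + 1`, hence below that at `k`,
contrary to the choice of `q + 2` for the dual order. -/
theorem not_nextSmaller_one_of_orderDual {β : Type*} [LinearOrder β] {t : ℕ → β} {k q : ℕ}
    (h1 : NextSmaller t k 1) (hq : NextSmaller (β := βᵒᵈ) t k (q + 2))
    (ht : t (k + (q + 1)) = t k) : False := by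
  have h2 := suffixAt_orderDual_lt_iff.1 (hq.2 (q + 1) (by omega) (by omega))
  have h3 := suffixAt_orderDual_lt_iff.1 hq.1
  exact lt_asymm ((suffixAt_succ_lt h2 ht).trans h1.1) h3

/-- `[s, e]` is a maximal repetition of the infinite word `t`, with least period `p`. -/
structure IsRun {β : Type*} (t : ℕ → β) (p s e : ℕ) : Prop where
  pos : 0 < p
  len : s + 2 * p ≤ e
  per : ∀ x, s ≤ x → x + p ≤ e → t x = t (x + p)
  least : ∀ d, 0 < d → d < p → ∃ x, s ≤ x ∧ x + d ≤ e ∧ t x ≠ t (x + d)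
  maximal : ∀ s' e', s' ≤ s → e ≤ e' → (∀ x, s' ≤ x → x + p ≤ e' → t x = t (x + p)) →
    s' = s ∧ e' = e

theorem IsRun.right_ne {β : Type*} {t : ℕ → β} {p s e : ℕ} (h : IsRun t p s e) :
    t (e + 1) ≠ t (e + 1 - p) := by
  intro heq
  have := h.maximal s (e + 1) (le_refl _) (by omega) (by
    intro x hx hxe
    rcases Nat.lt_or_ge e (x + p) with h' | h'
    · have h1 : x + p = e + 1 := by omega
      have h2 : x = e + 1 - p := by omega
      rw [h1, h2, heq]
    · exact h.per x hx h')
  omega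

/-- With `p` consecutive common positions starting at `k`, every pair `x`, `x + p` inside the union
lies in one of the two runs. The union thus has period `p`, and maximality of both runs applies. -/
theorem IsRun.eq_of_overlap {β : Type*} {t : ℕ → β} {p s e s' e' k : ℕ} (h : IsRun t p s e)
    (h' : IsRun t p s' e') (hs : s ≤ k) (hs' : s' ≤ k) (he : k + p ≤ e + 1)
    (he' : k + p ≤ e' + 1) : s = s' ∧ e = e' := by
  have hper : ∀ x, min s s' ≤ x → x + p ≤ max e e' → t x = t (x + p) := by
    intro x hx hxe
    rcases Nat.lt_or_ge x k with hk | hk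
    · rcases le_total s s' with hss | hss
      · exact h.per x (by omega) (by omega)
      · exact h'.per x (by omega) (by omega)
    · rcases le_total e e' with hss | hss
      · exact h'.per x (by omega) (by omega)
      · exact h.per x (by omega) (by omega)
  have h1 := h.maximal _ _ (min_le_left _ _) (le_max_left _ _) hper
  have h2 := h'.maximal _ _ (min_le_right _ _) (le_max_right _ _) hper
  omega

theorem IsRun.exists_nextSmaller {β : Type*} [LinearOrder β] {t : ℕ → β} {p s e : ℕ}
    (hr : IsRun t p s e) (hlt : t (e + 1) < t (e + 1 - p)) :
    ∃ k, s < k ∧ k ≤ s + p ∧ NextSmaller t k p := by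
  have hp := hr.pos
  have hlen := hr.len
  -- The periodic continuation of the first `p` letters of the run; it coincides with `t` up to
  -- position `e`, and all its rotations can be compared as infinite words.
  let g : ℕ → β := fun x => t (s + x % p)
  have hgp : ∀ x, g (x + p) = g x := fun x => by simp [g]
  have htg : ∀ x, s + x ≤ e → t (s + x) = g x := by
    intro x
    induction x using Nat.strong_induction_on with
    | _ x ih =>
    intro hx
    rcases Nat.lt_or_ge x p with h | h
    · simp [g, Nat.mod_eq_of_lt h]
    · have h1 := ih (x - p) (by omega) (by omega)
      have h2 := hr.per (s + (x - p)) (by omega) (by omega)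
      have h3 : s + (x - p) + p = s + x := by omega
      rw [h3] at h2
      rw [← h2, h1, ← hgp]
      congr 1; omega
  have hgmod : ∀ y, suffixAt g (y % p) = suffixAt g y := by
    intro y
    unfold suffixAt
    congr 1
    funext h
    simp [g, Nat.add_mod]
  -- The minimal rotation is taken with index in `[1, p]` instead of `[0, p)`, so that the letter
  -- before the anchor still belongs to the run; `IsRun.not_mixed` needs it.
  obtain ⟨x, hx1, hxp, hmin⟩ : ∃ x, 1 ≤ x ∧ x ≤ p ∧ ∀ y, suffixAt g x ≤ suffixAt g y := by
    obtain ⟨x, hx, hmin⟩ := Finset.exists_min_image (Finset.range p) (suffixAt g)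
      ⟨0, by simpa using hp⟩
    have hmin' : ∀ y, suffixAt g x ≤ suffixAt g y := fun y => by
      rw [← hgmod y]
      exact hmin _ (by simpa using Nat.mod_lt y hp)
    rcases Nat.eq_zero_or_pos x with rfl | hx0
    · refine ⟨p, hp, le_refl _, ?_⟩
      rw [← hgmod p]; simpa using hmin'
    · exact ⟨x, hx0, by simp at hx; omega, hmin'⟩
  refine ⟨s + x, by omega, by omega, ?_, ?_⟩
  · rw [suffixAt_lt_iff]
    refine ⟨e + 1 - p - (s + x), fun j hj => ?_, ?_⟩
    · have := hr.per (s + x + j) (by omega) (by omega)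
      rw [this]; congr 1; omega
    · have h1 : s + x + p + (e + 1 - p - (s + x)) = e + 1 := by omega
      have h2 : s + x + (e + 1 - p - (s + x)) = e + 1 - p := by omega
      rw [h1, h2]; exact hlt
  · intro d hd hdp
    -- Equality would give `g` the period `d` everywhere (shift an index past `x` by a multiple of
    -- `p`), against the minimality of `p`.
    have hne : suffixAt g x ≠ suffixAt g (x + d) := by
      intro heq
      have heq' : ∀ h, g (x + h) = g (x + d + h) := fun h => congrFun heq h
      have hgd : ∀ y, g y = g (y + d) := by
        intro y
        have h1 : ∀ z m, g (z + p * m) = g z := fun z m => by simp [g]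
        have h2 := heq' (y + (p * x - x))
        have h3 : x ≤ p * x := Nat.le_mul_of_pos_left x hp
        rw [← h1 y x, ← h1 (y + d) x]
        convert h2 using 2 <;> omega
      obtain ⟨z, hz1, hz2, hz3⟩ := hr.least d hd hdp
      apply hz3
      obtain ⟨z, rfl⟩ := Nat.exists_eq_add_of_le hz1
      rw [add_assoc, htg z (by omega), htg (z + d) (by omega), hgd]
    obtain ⟨h, h1, h2⟩ := lt_of_le_of_ne (hmin (x + d)) hne
    have h1' : ∀ j < h, g (x + j) = g (x + d + j) := h1
    have h2' : g (x + h) < g (x + d + h) := h2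
    -- The Lyndon root has no border: if the first `p - d` letters agreed, cancelling them would
    -- make the rotation at `x + (p - d)` smaller than the minimal one. So the mismatch lies inside
    -- the run, where `g` and `t` agree.
    have hh : h < p - d := by
      by_contra hcon
      obtain ⟨m, rfl⟩ := Nat.exists_eq_add_of_le (Nat.le_of_not_lt hcon)
      have e1 : ∀ j, x + (p - d) + j = x + (p - d + j) := fun j => by omega
      have e2 : ∀ j, x + d + (p - d + j) = x + j + p := fun j => by omega
      refine absurd (hmin (x + (p - d))) (not_le.2 ⟨m, fun j hj => ?_, ?_⟩)
      · change g (x + (p - d) + j) = g (x + j)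
        rw [e1, h1' _ (by omega), e2, hgp]
      · change g (x + (p - d) + m) < g (x + m)
        rw [e2, hgp] at h2'
        rwa [e1]
    refine ⟨h, fun j hj => ?_, ?_⟩
    · change t (s + x + j) = t (s + x + d + j)
      have := h1' j hj
      rw [← htg _ (by omega), ← htg _ (by omega)] at this
      simpa [add_assoc] using this
    · change t (s + x + h) < t (s + x + d + h)
      rw [← htg _ (by omega), ← htg _ (by omega)] at h2'
      simpa [add_assoc] using h2'

theorem IsRun.orderDual {β : Type*} {t : ℕ → β} {p s e : ℕ} (h : IsRun t p s e) :
    IsRun (β := βᵒᵈ) t p s e :=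
  ⟨h.pos, h.len, h.per, h.least, h.maximal⟩

/-- A position at which a Lyndon root of the run starts, for one of the two orders. -/
def IsAnchor {β : Type*} [LinearOrder β] (t : ℕ → β) (p s k : ℕ) : Prop :=
  s < k ∧ k ≤ s + p ∧ (NextSmaller t k p ∨ NextSmaller (β := βᵒᵈ) t k p)

theorem IsRun.exists_isAnchor {β : Type*} [LinearOrder β] {t : ℕ → β} {p s e : ℕ}
    (hr : IsRun t p s e) : ∃ k, IsAnchor t p s k := by
  rcases lt_or_gt_of_ne hr.right_ne with h | h
  · obtain ⟨k, h1, h2, h3⟩ := hr.exists_nextSmaller h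
    exact ⟨k, h1, h2, Or.inl h3⟩
  · obtain ⟨k, h1, h2, h3⟩ := hr.orderDual.exists_nextSmaller h
    exact ⟨k, h1, h2, Or.inr h3⟩

/-- If both periods exceed `1`, the two orders compare the suffixes at `k` and `k + 1` oppositely to
what is possible. If exactly one is `1`, the letter at `k - 1`, common to both runs, equals the
letter at `k` and the last letter of the longer root, which is the case of
`not_nextSmaller_one_of_orderDual`. -/
theorem IsRun.not_mixed {β : Type*} [LinearOrder β] {t : ℕ → β} {p s e p' s' e' k : ℕ}
    (hr : IsRun t p s e) (hr' : IsRun t p' s' e') (hs : s < k) (hkp : k ≤ s + p)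
    (hs' : s' < k) (hkp' : k ≤ s' + p')
    (h : NextSmaller t k p) (h' : NextSmaller (β := βᵒᵈ) t k p') : False := by
  have hp := hr.pos
  have hp' := hr'.pos
  have hlen := hr.len
  have hlen' := hr'.len
  have key : ∀ {q u v : ℕ}, IsRun t q u v → u < k → k ≤ u + q → t (k - 1) = t (k + q - 1) := by
    intro q u v hq hu hk
    have h1 := hq.len
    have h2 := hq.pos
    rw [hq.per (k - 1) (by omega) (by omega)]
    congr 1; omega
  have k1 := key hr hs hkp
  have k2 := key hr' hs' hkp'
  rcases Nat.lt_or_ge 1 p with h1 | h1 <;> rcases Nat.lt_or_ge 1 p' with h1' | h1'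
  · exact lt_asymm (h.2 1 one_pos h1) (suffixAt_orderDual_lt_iff.1 (h'.2 1 one_pos h1'))
  · obtain rfl : p' = 1 := by omega
    obtain ⟨q, rfl⟩ : ∃ q, p = q + 2 := ⟨p - 2, by omega⟩
    refine not_nextSmaller_one_of_orderDual (β := βᵒᵈ) h' h ?_
    change t _ = t _
    rw [show k + (q + 1) = k + (q + 2) - 1 by omega, ← k1, k2]
    rfl
  · obtain rfl : p = 1 := by omega
    obtain ⟨q, rfl⟩ : ∃ q, p' = q + 2 := ⟨p' - 2, by omega⟩
    refine not_nextSmaller_one_of_orderDual h h' ?_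
    rw [show k + (q + 1) = k + (q + 2) - 1 by omega, ← k2, k1]
    rfl
  · obtain rfl : p = 1 := by omega
    obtain rfl : p' = 1 := by omega
    exact lt_asymm h.1 (suffixAt_orderDual_lt_iff.1 h'.1)

theorem IsRun.eq_of_isAnchor {β : Type*} [LinearOrder β] {t : ℕ → β} {p s e p' s' e' k : ℕ}
    (hr : IsRun t p s e) (hr' : IsRun t p' s' e') (h : IsAnchor t p s k)
    (h' : IsAnchor t p' s' k) : s = s' ∧ e = e' := by
  obtain ⟨hs, hkp, h⟩ := h
  obtain ⟨hs', hkp', h'⟩ := h'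
  have hpp : p = p' := by
    rcases h with h | h <;> rcases h' with h' | h'
    · exact h.eq h' hr.pos hr'.pos
    · exact (hr.not_mixed hr' hs hkp hs' hkp' h h').elim
    · exact (hr'.not_mixed hr hs' hkp' hs hkp h' h).elim
    · exact h.eq h' hr.pos hr'.pos
  subst hpp
  have h1 := hr.len
  have h2 := hr'.len
  exact hr.eq_of_overlap hr' hs.le hs'.le (by omega) (by omega)

variable {α : Type*}

theorem length_slice {T : List α} {s e : ℕ} (he : e < T.length) :
    (slice T s e).length = e + 1 - s := by
  simp [slice]; omega

theorem getElem?_slice {T : List α} {s e x : ℕ} (hx : s + x ≤ e) :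
    (slice T s e)[x]? = T[s + x]? := by
  rw [slice, List.getElem?_take_of_lt (by omega), List.getElem?_drop]

theorem slice_hasPeriod_iff {T : List α} {s e q : ℕ} (he : e < T.length) :
    (slice T s e).HasPeriod q ↔ ∀ x, s ≤ x → x + q ≤ e → T[x]? = T[x + q]? := by
  rw [hasPeriod_iff, length_slice he]
  constructor
  · intro h x hx hxe
    obtain ⟨x, rfl⟩ := Nat.exists_eq_add_of_le hx
    have := h x (by omega)
    rwa [getElem?_slice (by omega), getElem?_slice (by omega), ← add_assoc] at this
  · intro h x hx
    rw [getElem?_slice (by omega), getElem?_slice (by omega), ← add_assoc]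
    exact h _ (by omega) (by omega)

theorem exists_isPeriodOf_of_hasPeriod {w : List α} {d : ℕ} (hd : 0 < d) (hdw : d ≤ w.length)
    (h : w.HasPeriod d) : ∃ q : List α, q ≠ [] ∧ q.length = d ∧ IsPeriodOf q w := by
  have hlen : (w.take d).length = d := by simp [hdw]
  have hne : w.take d ≠ [] := List.ne_nil_of_length_pos (by omega)
  exact ⟨w.take d, hne, hlen, (isPeriodOf_iff hne).2 ⟨List.take_prefix _ _, by rwa [hlen]⟩⟩

theorem IsPeriodSequenceWith.isRun {T p : List α} {s e : ℕ} (h : IsPeriodSequenceWith T p s e) :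
    IsRun (fun x => T[x]?) p.length s e := by
  obtain ⟨hse, he, hp, hlen, hmax⟩ := h
  have hpos : 0 < p.length := List.length_pos_of_ne_nil hp.1
  refine ⟨hpos, by omega, ?_, ?_, ?_⟩
  · exact (slice_hasPeriod_iff he).1 ((isPeriodOf_iff hp.1).1 hp.2.1).2
  · intro d hd hdp
    by_contra hcon
    push Not at hcon
    obtain ⟨q, hq, hql, hqp⟩ := exists_isPeriodOf_of_hasPeriod (w := slice T s e) hd
      (by rw [length_slice he]; omega) ((slice_hasPeriod_iff he).2 hcon)
    have := hp.2.2 q hq hqp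
    omega
  · intro s' e' hs' he' hper
    -- Past the end all letters are `none`; an extension reaching there would equate a letter of
    -- `T`, at distance `p.length` before, with `none`.
    have hel : e' < T.length := by
      by_contra hcon
      have h1 : T[T.length - p.length]? = T[T.length - p.length + p.length]? :=
        hper (T.length - p.length) (by omega) (by omega)
      have h2 : T[T.length - p.length + p.length]? = none :=
        List.getElem?_eq_none_iff.2 (by omega)
      rw [h2, List.getElem?_eq_none_iff] at h1
      omega
    refine hmax s' e' hs' he' hel ?_
    obtain ⟨q, -, hql, hqp⟩ := exists_isPeriodOf_of_hasPeriod (w := slice T s' e') hpos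
      (by rw [length_slice hel]; omega) ((slice_hasPeriod_iff hel).2 hper)
    exact ⟨q, hql, hqp⟩

theorem encard_le_of_injective_rel {γ : Type*} {S : Set γ} {n : ℕ} (R : γ → ℕ → Prop)
    (hR : ∀ x ∈ S, ∃ k < n, R x k) (hinj : ∀ x ∈ S, ∀ y ∈ S, ∀ k, R x k → R y k → x = y) :
    S.encard ≤ n := by
  choose! f hf hf' using hR
  have h1 : Set.InjOn f S := fun x hx y hy hxy =>
    hinj x hx y hy (f x) (hf' x hx) (hxy ▸ hf' y hy)
  rw [← h1.encard_image]
  have h2 : f '' S ⊆ (Finset.range n : Set ℕ) := by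
    rintro _ ⟨x, hx, rfl⟩
    simpa using hf x hx
  refine (Set.encard_le_encard h2).trans ?_
  rw [Set.encard_coe_eq_coe_finsetCard]
  simp

/-- Any linear order on the letters will do, so one is taken from a well-ordering. Each run has an
anchor below `T.length`, and an anchor determines its run. -/
theorem encard_periodSequences_le (T : List α) :
    {x : ℕ × ℕ | IsPeriodSequence T x.1 x.2}.encard ≤ (T.length : ℕ∞) := by
  classical
  let _ : LinearOrder (Option α) := linearOrderOfSTO (WellOrderingRel (α := Option α))
  refine encard_le_of_injective_rel
    (fun x k => ∃ p, IsRun (fun x => T[x]?) p x.1 x.2 ∧ IsAnchor (fun x => T[x]?) p x.1 k) ?_ ?_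
  · rintro ⟨s, e⟩ ⟨p, hp⟩
    obtain ⟨k, hk⟩ := hp.isRun.exists_isAnchor
    have h1 := hp.isRun.len
    have h2 := hp.2.1
    have h3 := hp.isRun.pos
    exact ⟨k, by have := hk.2.1; omega, _, hp.isRun, hk⟩
  · rintro ⟨s, e⟩ - ⟨s', e'⟩ - k ⟨p, h1, h2⟩ ⟨p', h1', h2'⟩
    have := h1.eq_of_isAnchor h1' h2 h2'
    exact Prod.ext this.1 this.2

end Runs

/-! ### Counting period paths by last occurrences of squares -/

section Paths
variable {α : Type*}

theorem getElem?_of_occursAt_append_self {p T : List α} {i x : ℕ} (h : OccursAt (p ++ p) T i)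
    (hx : x < p.length) : T[i + x]? = p[x]? ∧ T[i + (x + p.length)]? = p[x]? := by
  rw [h.getElem? (by simp; omega), h.getElem? (by simp; omega),
    List.getElem?_append_left hx, List.getElem?_append_right (by omega)]
  simp

/-- A version of the Fraenkel–Simpson three squares argument: the differences of the three lengths
become periods of `u` and `v`, short enough for Fine and Wilf to contradict the primitivity of `u`.
-/
theorem false_of_three_squares {T u v w : List α} {i : ℕ} (hu : IsPrimitive u)
    (hu2 : OccursAt (u ++ u) T i) (hv2 : OccursAt (v ++ v) T i) (hw2 : OccursAt (w ++ w) T i)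
    (huv : u.length < v.length) (hvw : v.length < w.length)
    (hlast : ∀ j, OccursAt (u ++ u) T j → j ≤ i) : False := by
  have hun := hu2.add_length_le
  have hwn := hw2.add_length_le
  have sq : ∀ {p : List α}, OccursAt (p ++ p) T i → ∀ x y, x < p.length → x + p.length = y →
      T[i + x]? = T[i + y]? := by
    rintro p hp x y hx rfl
    have h := getElem?_of_occursAt_append_self hp hx
    rw [h.1, h.2]
  have hpos : 0 < u.length := List.length_pos_of_ne_nil hu.1
  -- Otherwise `u ++ u` is a prefix of `w`, and the second copy of `w` contains a later occurrence
  -- of it.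
  have hshort : w.length < 2 * u.length := by
    by_contra hcon
    have := hlast (i + w.length) (occursAt_of_getElem? (by simp at *; omega) fun x hx => by
      simp only [List.length_append] at hx
      rw [← hu2.getElem? (by simpa using hx), add_assoc]
      exact (sq hw2 x _ (by omega) (by omega)).symm)
    omega
  have getu : ∀ x, x < u.length → u[x]? = T[i + x]? := fun x hx =>
    (getElem?_of_occursAt_append_self hu2 hx).1.symm
  have getv : ∀ x, x < v.length → v[x]? = T[i + x]? := fun x hx =>
    (getElem?_of_occursAt_append_self hv2 hx).1.symm
  have hu1 : u.HasPeriod (v.length - u.length) := by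
    rw [hasPeriod_iff]
    intro x hx
    rw [getu x (by omega), getu _ hx, sq hv2 x (x + v.length) (by omega) rfl,
      sq hu2 (x + (v.length - u.length)) (x + v.length) hx (by omega)]
  have hv1 : v.HasPeriod (w.length - v.length) := by
    rw [hasPeriod_iff]
    intro x hx
    rw [getv x (by omega), getv _ hx, sq hw2 x (x + w.length) (by omega) rfl,
      sq hv2 (x + (w.length - v.length)) (x + w.length) hx (by omega)]
  have hva : v.HasPeriod u.length := by
    rw [hasPeriod_iff]
    intro x hx
    rw [getv x (by omega), getv _ hx, sq hu2 x (x + u.length) (by omega) rfl]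
  have huv' : u <+: v := by
    rw [List.prefix_iff_getElem?]
    intro x hx
    rw [getv x (by omega), ← getu x hx, List.getElem?_eq_getElem hx]
  -- The two differences add up to `w.length - u.length < u.length`, so `u` has period `g`. It
  -- passes to `v`, because `v` has the multiple `w.length - v.length` of `g` as a period. Then `v`
  -- has periods `u.length` and `g`, with sum at most `v.length`.
  obtain ⟨g, hg⟩ : ∃ g, g = (v.length - u.length).gcd (w.length - v.length) := ⟨_, rfl⟩
  have hg1 : g ∣ v.length - u.length := hg ▸ Nat.gcd_dvd_left _ _
  have hg2 : g ∣ w.length - v.length := hg ▸ Nat.gcd_dvd_right _ _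
  have hgle := Nat.le_of_dvd (by omega) hg1
  have hug : u.HasPeriod g := hg ▸ hu1.gcd (hv1.infix huv'.isInfix) (by omega)
  have htl : (v.take (w.length - v.length)).length = w.length - v.length := by
    rw [List.length_take]; omega
  have hvg : v.HasPeriod g := by
    refine hasPeriod_of_prefix_of_dvd (p := v.take (w.length - v.length))
      (List.ne_nil_of_length_pos (by omega)) (List.take_prefix _ _) (by rwa [htl])
      (hug.infix ?_) (by rwa [htl])
    exact (List.prefix_of_prefix_length_le (List.take_prefix _ _) huv' (by omega)).isInfix
  have hvgcd := hva.gcd hvg (by omega)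
  have h1 := hu.2 _ (Nat.gcd_pos_of_pos_left _ hpos) (Nat.gcd_dvd_left _ _)
    (hvgcd.infix huv'.isInfix)
  have h2 : u.length ∣ g := by rw [← h1]; exact Nat.gcd_dvd_right _ _
  have := Nat.le_of_dvd (Nat.pos_of_dvd_of_pos hg1 (by omega)) h2
  omega

theorem IsPathPeriod.exists_last_square {T p : List α} (h : IsPathPeriod T p) :
    ∃ i < T.length, OccursAt (p ++ p) T i ∧ ∀ j, OccursAt (p ++ p) T j → j ≤ i := by
  classical
  obtain ⟨hp, P, hPT, hc⟩ := isPathPeriod_iff.1 h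
  have hpos : 0 < p.length := List.length_pos_of_ne_nil hp.1
  have hc' := continues_iff.1 hc
  have hpp : p ++ p <+: P := by
    have h1 := hc'.2.2.1
    have h2 : P.take p.length = p := (List.prefix_iff_eq_take.1 hc'.2.1).symm
    unfold List.HasPeriod at h1
    rw [h2] at h1
    exact List.prefix_of_prefix_length_le ((List.prefix_append_right_inj p).2 hc'.2.1) h1
      (by simp; omega)
  obtain ⟨i, hi⟩ := isInfix_iff_occursAt.1 (hpp.isInfix.trans hPT)
  have hb : ∀ j, OccursAt (p ++ p) T j → j ≤ T.length := fun j hj => hj.1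
  refine ⟨Nat.findGreatest (OccursAt (p ++ p) T) T.length, ?_,
    Nat.findGreatest_spec (P := OccursAt (p ++ p) T) (hb i hi) hi,
    fun j hj => Nat.le_findGreatest (hb j hj) hj⟩
  have := (Nat.findGreatest_spec (P := OccursAt (p ++ p) T) (hb i hi) hi).add_length_le
  simp at this
  omega

theorem encard_isPathPeriod_le (T : List α) :
    {p | IsPathPeriod T p}.encard ≤ ((2 * T.length : ℕ) : ℕ∞) := by
  classical
  let L : List α → ℕ → Prop := fun p i =>
    OccursAt (p ++ p) T i ∧ ∀ j, OccursAt (p ++ p) T j → j ≤ i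
  -- At most two path periods have their last square at `i`. The shorter is coded by `2 * i` and the
  -- longer, recognised by `B`, by `2 * i + 1`.
  let B : List α → ℕ → Prop := fun p i => ∃ q, IsPathPeriod T q ∧ L q i ∧ q.length < p.length
  have hne : ∀ {p q : List α} {i}, L p i → L q i → p.length = q.length → p = q := by
    intro p q i hp hq hlen
    have h1 : p <+: T.drop i := (List.prefix_append _ _).trans hp.1.2
    have h2 : q <+: T.drop i := (List.prefix_append _ _).trans hq.1.2
    exact (List.prefix_of_prefix_length_le h1 h2 hlen.le).eq_of_length hlen
  refine encard_le_of_injective_rel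
    (fun p k => ∃ i, L p i ∧ ((¬ B p i ∧ k = 2 * i) ∨ (B p i ∧ k = 2 * i + 1))) ?_ ?_
  · intro p hp
    obtain ⟨i, hi, hL⟩ := hp.exists_last_square
    by_cases hB : B p i
    · exact ⟨2 * i + 1, by omega, i, hL, Or.inr ⟨hB, rfl⟩⟩
    · exact ⟨2 * i, by omega, i, hL, Or.inl ⟨hB, rfl⟩⟩
  · have key : ∀ p q : List α, IsPathPeriod T p → IsPathPeriod T q → ∀ i, L p i → L q i →
        (B p i ↔ B q i) → ¬ p.length < q.length := by
      intro p q hp hq i hLp hLq hB hlt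
      obtain ⟨r, hr, hLr, hrp⟩ := hB.2 ⟨p, hp, hLp, hlt⟩
      exact false_of_three_squares hr.isPrimitive hLr.1 hLp.1 hLq.1 hrp hlt hLr.2
    rintro p hp q hq k ⟨i, hLp, h⟩ ⟨j, hLq, h'⟩
    have hij : i = j ∧ (B p i ↔ B q j) := by
      rcases h with ⟨h1, h2⟩ | ⟨h1, h2⟩ <;> rcases h' with ⟨h1', h2'⟩ | ⟨h1', h2'⟩
      · exact ⟨by omega, by simp [h1, h1']⟩
      · omega
      · omega
      · exact ⟨by omega, by simp [h1, h1']⟩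
    obtain ⟨rfl, hB⟩ := hij
    have h1 := key p q hp hq i hLp hLq hB
    have h2 := key q p hq hp i hLq hLp hB.symm
    exact hne hLp hLq (by omega)

theorem IsPeriodSequence.existsUnique_path {T : List α} {s e : ℕ} (h : IsPeriodSequence T s e) :
    ∃! p : List α, BelongsToPath T p s e := by
  obtain ⟨p, hse, he, hp, hlen, -⟩ := h
  have hc : Continues p (slice T s e) := ⟨hp.1, hp.2.1, by rw [length_slice he]; exact hlen⟩
  have hinf : slice T s e <:+: T :=
    (List.take_prefix _ _).isInfix.trans (List.drop_suffix _ _).isInfix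
  refine ⟨p, ⟨isPathPeriod_iff.2 ⟨hp.isPrimitive, _, hinf, hc⟩, hc⟩, ?_⟩
  rintro q ⟨hq, hqc⟩
  exact hq.isPrimitive.eq_of_continues hp.isPrimitive hqc hc

end Paths

/-! ### Size of the suffix tree and properties of loci -/

section SuffixTree

theorem isPrefix_or_exists_branch {β : Type*} (a b : List β) :
    a <+: b ∨ b <+: a ∨ ∃ c x y, x ≠ y ∧ c ++ [x] <+: a ∧ c ++ [y] <+: b := by
  induction a generalizing b with
  | nil => exact Or.inl List.nil_prefix
  | cons x a ih =>
    rcases b with _ | ⟨y, b⟩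
    · exact Or.inr (Or.inl List.nil_prefix)
    · by_cases hxy : x = y
      · subst hxy
        rcases ih b with h | h | ⟨c, u, v, huv, h1, h2⟩
        · exact Or.inl ((List.prefix_append_right_inj [x]).2 h)
        · exact Or.inr (Or.inl ((List.prefix_append_right_inj [x]).2 h))
        · exact Or.inr (Or.inr ⟨x :: c, u, v, huv, (List.prefix_append_right_inj [x]).2 h1,
            (List.prefix_append_right_inj [x]).2 h2⟩)
      · exact Or.inr (Or.inr ⟨[], x, y, hxy, by simp, by simp⟩)

theorem eq_of_append_singleton_prefix {β : Type*} {c X : List β} {x y : β}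
    (h1 : c ++ [x] <+: X) (h2 : c ++ [y] <+: X) : x = y := by
  have := (List.prefix_of_prefix_length_le h1 h2 (by simp)).eq_of_length (by simp)
  simpa using this

theorem append_singleton_prefix_of_lt {β : Type*} {w w' X : List β} {c : β}
    (h : w ++ [c] <+: X) (h' : w' <+: X) (hlt : w.length < w'.length) : w ++ [c] <+: w' :=
  List.prefix_of_prefix_length_le h h' (by simpa using hlt)

/-- The words which can be continued in two ways inside `U`. -/
def branchingWords {β : Type*} (U : List β) : Set (List β) :=
  {w | ∃ c c', c ≠ c' ∧ w ++ [c] <:+: U ∧ w ++ [c'] <:+: U}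

/-- Prepending a letter creates at most one branching word. A new one has an extension that is a
prefix of `x :: U` and does not occur in `U`; if a longer new one existed, it would contain this
extension and occur in `U`. -/
theorem encard_branchingWords_le {β : Type*} (U : List β) :
    (branchingWords U).encard ≤ (U.length : ℕ∞) := by
  induction U with
  | nil =>
    have : branchingWords ([] : List β) = ∅ := by
      ext w; simp [branchingWords]
    simp [this]
  | cons x U ih =>
    have hnew : ∀ w ∈ branchingWords (x :: U) \ branchingWords U, ∃ c c',
        w ++ [c] <+: x :: U ∧ ¬ w ++ [c] <:+: U ∧ w ++ [c'] <:+: U := by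
      rintro w ⟨⟨c, c', hne, h1, h2⟩, hnot⟩
      rw [List.infix_cons_iff] at h1 h2
      by_cases hc : w ++ [c] <:+: U
      · have hc' : ¬ w ++ [c'] <:+: U := fun hc' => hnot ⟨c, c', hne, hc, hc'⟩
        exact ⟨c', c, h2.resolve_right hc', hc', hc⟩
      · refine ⟨c, c', h1.resolve_right hc, hc, ?_⟩
        exact h2.resolve_left fun h => hne (eq_of_append_singleton_prefix (h1.resolve_right hc) h)
    have key : ∀ w ∈ branchingWords (x :: U) \ branchingWords U,
        ∀ w' ∈ branchingWords (x :: U) \ branchingWords U, ¬ w.length < w'.length := by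
      intro w hw w' hw' hlt
      obtain ⟨c, -, h1, h2, -⟩ := hnew w hw
      obtain ⟨d, d', h1', -, h3'⟩ := hnew w' hw'
      exact h2 (((append_singleton_prefix_of_lt h1 ((List.prefix_append _ _).trans h1') hlt).trans
        (List.prefix_append _ [d'])).isInfix.trans h3')
    have hone : (branchingWords (x :: U) \ branchingWords U).encard ≤ 1 := by
      rw [Set.encard_le_one_iff]
      intro w w' hw hw'
      have h1 := key w hw w' hw'
      have h2 := key w' hw' w hw
      obtain ⟨c, -, h3, -⟩ := hnew w hw
      obtain ⟨d, -, h3', -⟩ := hnew w' hw'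
      exact (List.prefix_of_prefix_length_le ((List.prefix_append _ _).trans h3)
        ((List.prefix_append _ _).trans h3') (by omega)).eq_of_length (by omega)
    calc (branchingWords (x :: U)).encard
        ≤ (branchingWords U ∪ (branchingWords (x :: U) \ branchingWords U)).encard :=
          Set.encard_le_encard (by intro w hw; by_cases h : w ∈ branchingWords U <;> simp [h, hw])
      _ ≤ _ := Set.encard_union_le _ _
      _ ≤ (U.length : ℕ∞) + 1 := add_le_add ih hone
      _ = _ := by simp

theorem encard_suffixes_le {β : Type*} (U : List β) :
    {w : List β | w ≠ [] ∧ w <:+ U}.encard ≤ (U.length : ℕ∞) := by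
  refine encard_le_of_injective_rel (fun w k => w.length = k + 1) ?_ ?_
  · rintro w ⟨hw, hU⟩
    have := List.length_pos_of_ne_nil hw
    have := hU.length_le
    exact ⟨w.length - 1, by omega, by omega⟩
  · rintro w ⟨-, hw⟩ w' ⟨-, hw'⟩ k h h'
    exact (List.suffix_of_suffix_length_le hw hw' (by omega)).eq_of_length (by omega)

variable {α : Type*}

theorem length_terminated (T : List α) : (terminated T).length = T.length + 1 := by
  simp [terminated]

theorem encard_isTreeNode_le (T : List α) :
    {w | IsTreeNode T w}.encard ≤ ((2 * T.length + 3 : ℕ) : ℕ∞) := by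
  have h1 := encard_suffixes_le (terminated T)
  have h2 := encard_branchingWords_le (terminated T)
  rw [length_terminated] at h1 h2
  calc {w | IsTreeNode T w}.encard
      ≤ ({[]} ∪ ({w | w ≠ [] ∧ w <:+ terminated T} ∪ branchingWords (terminated T))).encard :=
        Set.encard_le_encard (by rintro w (h | h | h) <;> simp_all [branchingWords])
    _ ≤ 1 + (((T.length + 1 : ℕ) : ℕ∞) + ((T.length + 1 : ℕ) : ℕ∞)) :=
        (Set.encard_union_le _ _).trans (add_le_add (by simp)
          ((Set.encard_union_le _ _).trans (add_le_add h1 h2)))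
    _ = _ := by norm_cast; omega

theorem IsTreeNode.isInfix {T : List α} {w : List (Option α)} (h : IsTreeNode T w) :
    w <:+: terminated T := by
  rcases h with rfl | h | ⟨c, c', -, h, -⟩
  · exact List.nil_infix
  · exact h.2.isInfix
  · exact (List.prefix_append _ _).isInfix.trans h

theorem isTreeNode_of_isSuffix {T : List α} {w : List (Option α)} (h : w <:+ terminated T) :
    IsTreeNode T w := by
  by_cases hw : w = []
  · exact Or.inl hw
  · exact Or.inr (Or.inl ⟨hw, h⟩)

/-- If the two labels diverged, the word at which they do so would be a branching node below `X`
that is higher than the locus. -/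
theorem IsLocus.isPrefix {T : List α} {X w w' : List (Option α)} (h : IsLocus T X w)
    (hw' : IsTreeNode T w') (hX : X <+: w') : w <+: w' := by
  have hlen := h.2.2 w' hw' hX
  rcases isPrefix_or_exists_branch w w' with h1 | h1 | ⟨c, x, y, hxy, h1, h2⟩
  · exact h1
  · rw [h1.eq_of_length (le_antisymm h1.length_le hlen)]
  · exfalso
    have hc : IsTreeNode T c := Or.inr (Or.inr ⟨x, y, hxy, h1.isInfix.trans h.1.isInfix,
      h2.isInfix.trans hw'.isInfix⟩)
    have hXc : X <+: c := by
      rcases Nat.lt_or_ge c.length X.length with hl | hl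
      · exact absurd (eq_of_append_singleton_prefix (append_singleton_prefix_of_lt h1 h.2.1 hl)
          (append_singleton_prefix_of_lt h2 hX hl)) hxy
      · exact List.prefix_of_prefix_length_le h.2.1 ((List.prefix_append _ _).trans h1) hl
    have h3 := h.2.2 c hc hXc
    have h4 := h1.length_le
    simp at h4
    omega

theorem IsLocus.eq {T : List α} {X w w' : List (Option α)} (h : IsLocus T X w)
    (h' : IsLocus T X w') : w = w' :=
  (h.isPrefix h'.1 h'.2.1).eq_of_length
    (le_antisymm (h.2.2 _ h'.1 h'.2.1) (h'.2.2 _ h.1 h.2.1))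

theorem exists_isLocus {T : List α} {X : List (Option α)} (h : X <:+: terminated T) :
    ∃ w, IsLocus T X w := by
  classical
  obtain ⟨z, hXz, hz⟩ := List.infix_iff_prefix_suffix.1 h
  have hex : ∃ k, ∃ w, IsTreeNode T w ∧ X <+: w ∧ w.length = k :=
    ⟨_, z, isTreeNode_of_isSuffix hz, hXz, rfl⟩
  obtain ⟨w, h1, h2, h3⟩ := Nat.find_spec hex
  exact ⟨w, h1, h2, fun w' h1' h2' => h3 ▸ Nat.find_min' hex ⟨w', h1', h2', rfl⟩⟩

/-- The suffix of the text at `i` is itself a node label, so it begins with the locus of each of its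
prefixes. -/
theorem IsLocus.occursAt {T : List α} {X w : List (Option α)} (h : IsLocus T X w) {i : ℕ}
    (hi : OccursAt X (terminated T) i) : OccursAt w (terminated T) i :=
  ⟨hi.1, h.isPrefix (isTreeNode_of_isSuffix (List.drop_suffix _ _)) hi.2⟩

/-- A node is the locus of every prefix of its label which is longer than a prefix with that
locus. -/
theorem IsLocus.of_isPrefix {T : List α} {X Y w : List (Option α)} (h : IsLocus T X w)
    (hXY : X <+: Y) (hY : Y <+: w) : IsLocus T Y w :=
  ⟨h.1, hY, fun w' hw' hYw' => h.2.2 w' hw' (hXY.trans hYw')⟩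

theorem OccursAt.map_some_terminated {P T : List α} {i : ℕ} (h : OccursAt P T i) :
    OccursAt (P.map some) (terminated T) i := by
  refine ⟨by rw [length_terminated]; have := h.1; omega, ?_⟩
  rw [terminated, List.drop_append_of_le_length (by simpa using h.1), ← List.map_drop]
  exact (h.2.map some).trans (List.prefix_append _ _)

theorem occursAt_map_some_terminated_iff {P T : List α} {i : ℕ} (hP : P ≠ []) :
    OccursAt (P.map some) (terminated T) i ↔ OccursAt P T i := by
  refine ⟨fun h => ?_, fun h => h.map_some_terminated⟩
  have hlen := h.add_length_le
  rw [length_terminated, List.length_map] at hlen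
  have hget : ∀ x, x < P.length → (terminated T)[i + x]? = (P.map some)[x]? := fun x hx =>
    h.getElem? (by simpa using hx)
  have hpos : 0 < P.length := List.length_pos_of_ne_nil hP
  have hle : i + P.length ≤ T.length := by
    by_contra hcon
    have h1 := hget (P.length - 1) (by omega)
    have h2 : i + (P.length - 1) = T.length := by omega
    rw [h2] at h1
    simp [terminated, hpos] at h1
  refine occursAt_of_getElem? hle fun x hx => ?_
  have := hget x hx
  rw [terminated, List.getElem?_append_left (by simp; omega), List.getElem?_map,
    List.getElem?_map] at this
  exact Option.map_injective (Option.some_injective α) this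

theorem map_some_isInfix_terminated_iff {P T : List α} (hP : P ≠ []) :
    P.map some <:+: terminated T ↔ P <:+: T := by
  rw [isInfix_iff_occursAt, isInfix_iff_occursAt]
  exact exists_congr fun i => occursAt_map_some_terminated_iff hP

theorem isPrefix_map_some_iff {P Q : List α} : P.map some <+: Q.map some ↔ P <+: Q := by
  constructor
  · intro h
    rw [List.prefix_iff_eq_take, List.length_map, ← List.map_take] at h
    rw [List.prefix_iff_eq_take]
    exact List.map_injective_iff.2 (Option.some_injective α) h
  · exact fun h => h.map some

theorem exists_eq_map_some_of_isPrefix {Q : List α} {w : List (Option α)}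
    (h : w <+: Q.map some) : ∃ P : List α, P <+: Q ∧ w = P.map some := by
  refine ⟨Q.take w.length, List.take_prefix _ _, ?_⟩
  rw [List.map_take]; exact List.prefix_iff_eq_take.1 h

end SuffixTree

/-! ### Linear space and the size of the stored numbers -/

section Space

theorem length_le_of_encard_le {γ : Type*} {l : List γ} {S : Set γ} {k : ℕ} (hl : l.Nodup)
    (hS : ∀ x ∈ l, x ∈ S) (hk : S.encard ≤ k) : l.length ≤ k := by
  classical
  have h1 : ((l.toFinset : Finset γ) : Set γ).encard ≤ S.encard :=
    Set.encard_le_encard (by intro x hx; exact hS x (by simpa using hx))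
  rw [Set.encard_coe_eq_coe_finsetCard, List.toFinset_card_of_nodup hl] at h1
  exact_mod_cast h1.trans hk

theorem getElem?_injective_of_nodup {γ : Type*} {l : List γ} (hl : l.Nodup) {i j : ℕ} {x : γ}
    (hi : l[i]? = some x) (hj : l[j]? = some x) : i = j := by
  have h := (List.getElem?_eq_some_iff.1 hi).1
  exact (List.getElem?_inj h hl).1 (hi.trans hj.symm)

theorem le_sum_of_mem_map {γ : Type*} {l : List γ} {f : γ → ℕ} {x : γ} (hx : x ∈ l) :
    f x ≤ (l.map f).sum :=
  List.le_sum_of_mem (List.mem_map_of_mem hx)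

namespace IsPeriodIndexWith

variable {α : Type*} {T : List α} {M : PeriodIndex α} {periods : List (List α)}

theorem length_label (hM : IsPeriodIndexWith T M periods) {v : TreeNode α} (hv : v ∈ M.nodes) :
    (M.label v).length = v.depth := by
  have := hM.start_add_depth v hv
  simp [PeriodIndex.label]
  omega

theorem isTreeNode_label (hM : IsPeriodIndexWith T M periods) {v : TreeNode α}
    (hv : v ∈ M.nodes) : IsTreeNode T (M.label v) :=
  (hM.mem_nodes _).1 (List.mem_map_of_mem hv)

theorem eq_of_label_eq (hM : IsPeriodIndexWith T M periods) {u v : TreeNode α}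
    (hu : u ∈ M.nodes) (hv : v ∈ M.nodes) (h : M.label u = M.label v) : u = v :=
  List.inj_on_of_nodup_map hM.nodes_nodup hu hv h

theorem length_nodes_le (hM : IsPeriodIndexWith T M periods) :
    M.nodes.length ≤ 2 * T.length + 3 := by
  have := length_le_of_encard_le hM.nodes_nodup (fun w hw => (hM.mem_nodes w).1 hw)
    (encard_isTreeNode_le T)
  simpa using this

theorem length_periods_le (hM : IsPeriodIndexWith T M periods) :
    periods.length ≤ 2 * T.length :=
  length_le_of_encard_le hM.periods_nodup (fun w hw => (hM.mem_periods w).1 hw)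
    (encard_isPathPeriod_le T)

theorem exists_list (hM : IsPeriodIndexWith T M periods) {p : List α} (hp : IsPathPeriod T p) :
    ∃ (i : ℕ) (L : List (ℕ × ℕ)), periods[i]? = some p ∧ M.lists[i]? = some L := by
  obtain ⟨i, hi⟩ := List.mem_iff_getElem?.1 ((hM.mem_periods p).2 hp)
  have hlt := (List.getElem?_eq_some_iff.1 hi).1
  rw [← hM.length_lists] at hlt
  exact ⟨i, _, hi, List.getElem?_eq_getElem hlt⟩

theorem exists_period (hM : IsPeriodIndexWith T M periods) {i : ℕ} {L : List (ℕ × ℕ)}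
    (hL : M.lists[i]? = some L) : ∃ p, periods[i]? = some p := by
  have hlt := (List.getElem?_eq_some_iff.1 hL).1
  rw [hM.length_lists] at hlt
  exact ⟨_, List.getElem?_eq_getElem hlt⟩

theorem length_flatten_lists_le (hM : IsPeriodIndexWith T M periods) :
    (M.lists.map List.length).sum ≤ T.length := by
  rw [← List.length_flatten]
  refine length_le_of_encard_le ?_ ?_ (encard_periodSequences_le T)
  · rw [List.nodup_flatten]
    refine ⟨hM.lists_nodup, ?_⟩
    rw [List.pairwise_iff_getElem]
    intro i j hi hj hij
    rw [List.disjoint_left]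
    rintro ⟨s, e⟩ h h'
    obtain ⟨p, hp⟩ := hM.exists_period (List.getElem?_eq_getElem hi)
    obtain ⟨q, hq⟩ := hM.exists_period (List.getElem?_eq_getElem hj)
    have h1 := (hM.mem_lists i p _ hp (List.getElem?_eq_getElem hi) s e).1 h
    have h2 := (hM.mem_lists j q _ hq (List.getElem?_eq_getElem hj) s e).1 h'
    obtain rfl := h1.1.existsUnique_path.unique h1.2 h2.2
    have := getElem?_injective_of_nodup hM.periods_nodup hp hq
    omega
  · rintro ⟨s, e⟩ h
    obtain ⟨L, hL, h⟩ := List.mem_flatten.1 h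
    obtain ⟨i, hi⟩ := List.mem_iff_getElem?.1 hL
    obtain ⟨p, hp⟩ := hM.exists_period hi
    exact ((hM.mem_lists i p L hp hi s e).1 h).1

/-- A node is a child only once: of two parents with different depths, the deeper one would be a
higher locus for the edge of the other. So the child indices stored in all dictionaries are
distinct. -/
theorem sum_length_children_le (hM : IsPeriodIndexWith T M periods) :
    (M.nodes.map fun v => v.children.length).sum ≤ M.nodes.length := by
  have key : ∀ v ∈ M.nodes, ∀ v' ∈ M.nodes, ∀ c c' i, (c, i) ∈ v.children →
      (c', i) ∈ v'.children → v = v' ∧ c = c' := by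
    intro v hv v' hv' c c' i h h'
    obtain ⟨u, hu, hl⟩ := (hM.mem_children v hv c i).1 h
    obtain ⟨u', hu', hl'⟩ := (hM.mem_children v' hv' c' i).1 h'
    obtain rfl : u = u' := by rw [hu] at hu'; exact Option.some_injective _ hu'
    have aux : ∀ {v v' : TreeNode α} {c c' : Option α}, v' ∈ M.nodes →
        IsLocus T (M.label v ++ [c]) (M.label u) → IsLocus T (M.label v' ++ [c']) (M.label u) →
        ¬ (M.label v).length < (M.label v').length := by
      intro v v' c c' hv' hl hl' hlt
      have h1 := append_singleton_prefix_of_lt hl.2.1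
        ((List.prefix_append _ _).trans hl'.2.1) hlt
      have h2 := hl.2.2 _ (hM.isTreeNode_label hv') h1
      have h3 := hl'.2.1.length_le
      simp at h3
      omega
    have hlen : (M.label v).length = (M.label v').length := by
      have h1 := aux hv' hl hl'
      have h2 := aux hv hl' hl
      omega
    have hlab := (List.prefix_of_prefix_length_le ((List.prefix_append _ _).trans hl.2.1)
      ((List.prefix_append _ _).trans hl'.2.1) hlen.le).eq_of_length hlen
    refine ⟨hM.eq_of_label_eq hv hv' hlab, ?_⟩
    exact eq_of_append_singleton_prefix hl.2.1 (hlab ▸ hl'.2.1)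
  have hnd : (M.nodes.flatMap fun v => v.children.map Prod.snd).Nodup := by
    rw [List.nodup_flatMap]
    refine ⟨fun v hv => ?_, ?_⟩
    · refine (List.Nodup.of_map _ (hM.keys_nodup v hv)).map_on ?_
      rintro ⟨c, i⟩ h ⟨c', i'⟩ h' hii
      obtain rfl : i = i' := hii
      rw [(key v hv v hv c c' i h h').2]
    · refine (List.Nodup.of_map _ hM.nodes_nodup).imp_of_mem ?_
      intro v v' hv hv' hne
      simp only [Function.onFun, List.disjoint_left, List.mem_map]
      rintro i ⟨⟨c, i⟩, h, rfl⟩ ⟨⟨c', i'⟩, h', hii⟩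
      obtain rfl : i' = i := hii
      exact hne (key v hv v' hv' c c' i' h h').1
  have hsub : (M.nodes.flatMap fun v => v.children.map Prod.snd) ⊆ List.range M.nodes.length := by
    intro i hi
    obtain ⟨v, hv, hi⟩ := List.mem_flatMap.1 hi
    obtain ⟨⟨c, i⟩, h, rfl⟩ := List.mem_map.1 hi
    obtain ⟨u, hu, -⟩ := (hM.mem_children v hv c i).1 h
    exact List.mem_range.2 (List.getElem?_eq_some_iff.1 hu).1
  have := (hnd.subperm hsub).length_le
  simpa [List.length_flatMap] using this

theorem exists_of_mem_paths (hM : IsPeriodIndexWith T M periods) {v : TreeNode α}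
    (hv : v ∈ M.nodes) {r : PathPtr} (hr : r ∈ v.paths) :
    ∃ p P, periods[r.list]? = some p ∧ IsPrimitive p ∧ r.period = p.length ∧
      P.length = r.last ∧ Continues p P ∧ IsLocus T (P.map some) (M.label v) := by
  obtain ⟨p, L, hp, hL, hvp, h1, ⟨⟨P, h2, h3, h4⟩, -⟩, h5⟩ := (hM.mem_paths v hv r).1 hr
  exact ⟨p, P, hp, ((hM.mem_periods p).1 (List.mem_of_getElem? hp)).isPrimitive, h1, h2, h3, h4⟩

theorem paths_eq_of_list_eq (hM : IsPeriodIndexWith T M periods) {v : TreeNode α}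
    (hv : v ∈ M.nodes) {r r' : PathPtr} (hr : r ∈ v.paths) (hr' : r' ∈ v.paths)
    (h : r.list = r'.list) : r = r' := by
  obtain ⟨p, L, hp, hL, -, h1, h2, h3⟩ := (hM.mem_paths v hv r).1 hr
  obtain ⟨p', L', hp', hL', -, h1', h2', h3'⟩ := (hM.mem_paths v hv r').1 hr'
  rw [← h] at hp' hL'
  obtain rfl : p = p' := Option.some_injective _ (hp.symm.trans hp')
  obtain rfl : L = L' := Option.some_injective _ (hL.symm.trans hL')
  have hlast := h2.unique h2'
  cases r; cases r'
  simp_all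

/-- Both paths contain the whole label, which determines its primitive period. -/
theorem paths_eq_of_full (hM : IsPeriodIndexWith T M periods) {v : TreeNode α}
    (hv : v ∈ M.nodes) {r r' : PathPtr} (hr : r ∈ v.paths) (hr' : r' ∈ v.paths)
    (h : r.last = v.depth) (h' : r'.last = v.depth) : r = r' := by
  obtain ⟨p, P, hp, hpp, -, h1, h2, h3⟩ := hM.exists_of_mem_paths hv hr
  obtain ⟨p', P', hp', hpp', -, h1', h2', h3'⟩ := hM.exists_of_mem_paths hv hr'
  have hl := hM.length_label hv
  have e1 : P.map some = M.label v := h3.2.1.eq_of_length (by simp; omega)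
  have e2 : P'.map some = M.label v := h3'.2.1.eq_of_length (by simp; omega)
  obtain rfl : P = P' := List.map_injective_iff.2 (Option.some_injective α) (e1.trans e2.symm)
  obtain rfl := hpp.eq_of_continues hpp' h2 h2'
  exact hM.paths_eq_of_list_eq hv hr hr' (getElem?_injective_of_nodup hM.periods_nodup hp hp')

/-- Words with the same period are comparable, so their loci lie on one branch. A path that
continues strictly below a node contains the entire label of that node. -/
theorem node_eq_of_not_full (hM : IsPeriodIndexWith T M periods) {v v' : TreeNode α}
    (hv : v ∈ M.nodes) (hv' : v' ∈ M.nodes) {r r' : PathPtr} (hr : r ∈ v.paths)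
    (hr' : r' ∈ v'.paths) (h : r.last ≠ v.depth) (h' : r'.last ≠ v'.depth)
    (hl : r.list = r'.list) : v = v' := by
  have aux : ∀ {v v' : TreeNode α} {r r' : PathPtr} {p P P' : List α}, v ∈ M.nodes →
      v' ∈ M.nodes → r ∈ v.paths → r.last ≠ v.depth → periods[r.list]? = some p →
      P.length = r.last → Continues p P →
      IsLocus T (P.map some) (M.label v) → Continues p P' →
      IsLocus T (P'.map some) (M.label v') → P.length ≤ P'.length → v = v' := by
    intro v v' r r' p P P' hv hv' hr h hp hPl h1 h2 h1' h2' hle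
    have hPP' := h1.prefix_of_length_le h1' hle
    have hvv' : M.label v <+: M.label v' :=
      h2.isPrefix h2'.1 ((isPrefix_map_some_iff.2 hPP').trans h2'.2.1)
    rcases Nat.lt_or_ge (M.label v).length (P'.map some).length with hlt | hge
    -- Here the label of `v` is a proper prefix of `P'`, hence continues `p` and is represented by
    -- `v`; so `last` would be the full depth.
    · exfalso
      have h3 := List.prefix_of_prefix_length_le hvv' h2'.2.1 hlt.le
      obtain ⟨Q, hQ, hvQ⟩ := exists_eq_map_some_of_isPrefix h3
      have h4 := h2.2.1.length_le
      have h5 := hM.length_label hv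
      have h6 := (continues_iff.1 h1).2.2.2
      have hQl : Q.length = v.depth := by rw [← h5, hvQ]; simp
      simp at h4
      have hQc : Continues p Q := h1'.of_prefix hQ (by omega)
      obtain ⟨q, L, hq, -, -, -, hgr, -⟩ := (hM.mem_paths v hv r).1 hr
      obtain rfl : p = q := Option.some_injective _ (hp.symm.trans hq)
      have := hgr.2 ⟨Q, rfl, hQc, hvQ ▸ h2.of_isPrefix h2.2.1 (List.prefix_refl _)⟩
      omega
    · have h3 := List.prefix_of_prefix_length_le h2'.2.1 hvv' hge
      have h4 := h2'.isPrefix h2.1 h3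
      exact hM.eq_of_label_eq hv hv' (hvv'.eq_of_length
        (le_antisymm hvv'.length_le h4.length_le))
  obtain ⟨p, P, hp, -, -, h1, h2, h3⟩ := hM.exists_of_mem_paths hv hr
  obtain ⟨p', P', hp', -, -, h1', h2', h3'⟩ := hM.exists_of_mem_paths hv' hr'
  obtain rfl : p = p' := by rw [← hl, hp] at hp'; exact Option.some_injective _ hp'
  rcases le_total P.length P'.length with hle | hle
  · exact aux (r' := r) hv hv' hr h hp h1 h2 h3 h2' h3' hle
  · exact (aux (r' := r) hv' hv hr' h' hp' h1' h2' h3' h2 h3 hle).symm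

theorem sum_length_paths_le (hM : IsPeriodIndexWith T M periods) :
    (M.nodes.map fun v => v.paths.length).sum ≤ M.nodes.length + periods.length := by
  -- A full record is charged to its node, any other one to its path; no node and no path is charged
  -- twice.
  let key : TreeNode α → PathPtr → List (Option α) ⊕ ℕ := fun v r =>
    if r.last = v.depth then Sum.inl (M.label v) else Sum.inr r.list
  have hnd : (M.nodes.flatMap fun v => v.paths.map (key v)).Nodup := by
    rw [List.nodup_flatMap]
    refine ⟨fun v hv => ?_, ?_⟩
    · have h1 : v.paths.Nodup :=
        (hM.paths_sorted v hv).imp fun h => by rintro rfl; exact lt_irrefl _ h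
      refine h1.map_on fun r hr r' hr' hk => ?_
      by_cases h : r.last = v.depth <;> by_cases h' : r'.last = v.depth <;> simp [key, h, h'] at hk
      · exact hM.paths_eq_of_full hv hr hr' h h'
      · exact hM.paths_eq_of_list_eq hv hr hr' hk
    · refine (List.Nodup.of_map _ hM.nodes_nodup).imp_of_mem ?_
      intro v v' hv hv' hne
      simp only [Function.onFun, List.disjoint_left, List.mem_map]
      rintro _ ⟨r, hr, rfl⟩ ⟨r', hr', hk⟩
      by_cases h : r.last = v.depth <;> by_cases h' : r'.last = v'.depth <;>
        simp [key, h, h'] at hk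
      · exact hne (hM.eq_of_label_eq hv hv' hk.symm)
      · exact hne (hM.node_eq_of_not_full hv hv' hr hr' h h' hk.symm)
  have hsub : (M.nodes.flatMap fun v => v.paths.map (key v)) ⊆
      (M.nodes.map M.label).map Sum.inl ++ (List.range periods.length).map Sum.inr := by
    intro x hx
    obtain ⟨v, hv, hx⟩ := List.mem_flatMap.1 hx
    obtain ⟨r, hr, rfl⟩ := List.mem_map.1 hx
    obtain ⟨p, P, hp, -⟩ := hM.exists_of_mem_paths hv hr
    have h1 := (List.getElem?_eq_some_iff.1 hp).1
    by_cases h : r.last = v.depth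
    · simpa [key, h] using ⟨v, hv, rfl⟩
    · simpa [key, h] using h1
  have := (hnd.subperm hsub).length_le
  simpa [List.length_flatMap] using this

theorem length_text (hM : IsPeriodIndexWith T M periods) : M.text.length = T.length + 1 := by
  rw [hM.text_eq, length_terminated]

theorem space_le (hM : IsPeriodIndexWith T M periods) :
    M.space ≤ 33 * T.length + 34 := by
  have h1 := hM.length_nodes_le
  have h2 := hM.length_periods_le
  have h3 := hM.length_flatten_lists_le
  have h4 := hM.sum_length_children_le
  have h5 := hM.sum_length_paths_le
  have h6 := hM.length_text
  have h7 := hM.length_lists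
  have e1 : M.letters.length = M.text.length + (M.nodes.map fun v => v.children.length).sum := by
    simp [PeriodIndex.letters, List.length_flatMap]
  have e2 : M.numbers.length = 3 +
      (M.nodes.map fun v => v.children.length + v.paths.length * 4 + 4).sum +
      (M.lists.map fun L => L.length * 2 + 1).sum := by
    simp [PeriodIndex.numbers, List.length_flatMap]
    omega
  rw [List.sum_map_add, List.sum_map_add, List.sum_map_add, List.sum_map_mul_right,
    List.sum_map_mul_right] at e2
  simp at e2
  unfold PeriodIndex.space
  omega

theorem le_of_mem_numbers (hM : IsPeriodIndexWith T M periods) {k : ℕ} (hk : k ∈ M.numbers) :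
    k ≤ 4 * T.length + 3 := by
  have h1 := hM.length_nodes_le
  have h2 := hM.length_periods_le
  have h3 := hM.length_flatten_lists_le
  have h4 := hM.sum_length_children_le
  have h5 := hM.sum_length_paths_le
  have h6 := hM.length_text
  have h7 := hM.length_lists
  unfold PeriodIndex.numbers at hk
  rw [List.mem_append, List.mem_append] at hk
  rcases hk with (hk | hk) | hk
  · simp at hk
    omega
  · obtain ⟨v, hv, hk⟩ := List.mem_flatMap.1 hk
    have h8 := hM.start_add_depth v hv
    have h9 := hM.length_label hv
    have h10 := le_sum_of_mem_map (f := fun v => v.children.length) hv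
    have h11 := le_sum_of_mem_map (f := fun v => v.paths.length) hv
    rw [List.mem_append, List.mem_append] at hk
    rcases hk with (hk | hk) | hk
    · simp at hk
      omega
    · obtain ⟨⟨c, i⟩, h, rfl⟩ := List.mem_map.1 hk
      obtain ⟨u, hu, -⟩ := (hM.mem_children v hv c i).1 h
      have := (List.getElem?_eq_some_iff.1 hu).1
      simp
      omega
    · obtain ⟨r, hr, hk⟩ := List.mem_flatMap.1 hk
      obtain ⟨p, P, hp, -, hrp, hP, hc, hl⟩ := hM.exists_of_mem_paths hv hr
      obtain ⟨q, L, hq, hL, -, -, -, ho⟩ := (hM.mem_paths v hv r).1 hr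
      have h12 := (continues_iff.1 hc).2.2.2
      have h13 := hl.2.1.length_le
      have h14 := (List.getElem?_eq_some_iff.1 hp).1
      have h15 := le_sum_of_mem_map (f := List.length) (List.mem_of_getElem? hL)
      have h16 := List.countP_le_length (l := L) (p := fun x => decide (x.2 + 1 - x.1 < r.last))
      simp at h13
      simp at hk
      omega
  · obtain ⟨L, hL, hk⟩ := List.mem_flatMap.1 hk
    have h8 := le_sum_of_mem_map (f := List.length) hL
    rcases List.mem_cons.1 hk with rfl | hk
    · omega
    · obtain ⟨⟨s, e⟩, h, hk⟩ := List.mem_flatMap.1 hk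
      obtain ⟨i, hi⟩ := List.mem_iff_getElem?.1 hL
      obtain ⟨p, hp⟩ := hM.exists_period hi
      obtain ⟨q, hse, he, -⟩ := ((hM.mem_lists i p L hp hi s e).1 h).1
      simp at hk
      omega

end IsPeriodIndexWith
end Space

/-! ### Correctness and running time of a query -/

section Query

theorem lookup_eq_some_iff_mem {γ δ : Type*} [BEq γ] [LawfulBEq γ] {l : List (γ × δ)}
    (hl : (l.map Prod.fst).Nodup) {c : γ} {i : δ} : l.lookup c = some i ↔ (c, i) ∈ l := by
  induction l with
  | nil => simp
  | cons x l ih =>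
    obtain ⟨a, b⟩ := x
    rw [List.map_cons, List.nodup_cons] at hl
    rw [List.lookup_cons]
    by_cases h : c = a
    · subst h
      have hnot : (c, i) ∉ l := fun h => hl.1 (by simpa using ⟨i, h⟩)
      simp [hnot, eq_comm]
    · have h' : (c == a) = false := by simpa using h
      simp [h', ih hl.2, h]

theorem mem_drop_countP_iff {γ : Type*} {f : γ → ℕ} {k : ℕ} {l : List γ}
    (hl : l.Pairwise fun x y => f x ≤ f y) {x : γ} :
    x ∈ l.drop (l.countP fun y => decide (f y < k)) ↔ x ∈ l ∧ k ≤ f x := by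
  induction l with
  | nil => simp
  | cons y l ih =>
    rw [List.pairwise_cons] at hl
    by_cases hy : f y < k
    · rw [List.countP_cons_of_pos (by simpa using hy), List.drop_succ_cons, ih hl.2, List.mem_cons]
      constructor
      · exact fun h => ⟨Or.inr h.1, h.2⟩
      · rintro ⟨rfl | h, h'⟩
        · omega
        · exact ⟨h, h'⟩
    · have h0 : (y :: l).countP (fun y => decide (f y < k)) = 0 := by
        rw [List.countP_eq_zero]
        intro z hz
        rcases List.mem_cons.1 hz with rfl | hz
        · simpa using hy
        · have := hl.1 z hz
          simp; omega
      rw [h0, List.drop_zero]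
      refine ⟨fun h => ⟨h, ?_⟩, fun h => h.1⟩
      rcases List.mem_cons.1 h with rfl | hz
      · omega
      · have := hl.1 x hz
        omega

/-- Greedy choice: keep the least element `a` and discard the others below `a + m`. Two discarded
ones would be separated from `a` and from each other by more than `m / 2`, so there is at most one.
-/
theorem exists_subset_of_gaps {m : ℕ} (hm : 0 < m) (S : Finset ℕ)
    (hS : ∀ a ∈ S, ∀ b ∈ S, a < b → m < 2 * (b - a)) :
    ∃ S' ⊆ S, S.card ≤ 2 * S'.card ∧ ∀ a ∈ S', ∀ b ∈ S', a < b → a + m ≤ b := by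
  induction hn : S.card using Nat.strong_induction_on generalizing S with
  | _ n ih =>
  rcases S.eq_empty_or_nonempty with rfl | hne
  · exact ⟨∅, by simp, by simp at hn; omega, by simp⟩
  · obtain ⟨a, ha, hmin⟩ := Finset.exists_min_image S id hne
    simp only [id] at hmin
    have hfar : (S.filter fun x => a + m ≤ x).card < n := by
      rw [← hn]
      exact Finset.card_lt_card (Finset.filter_ssubset.2 ⟨a, ha, by omega⟩)
    obtain ⟨S', hsub, hcard, hgap⟩ := ih _ hfar (S.filter fun x => a + m ≤ x)
      (fun x hx y hy => hS x (Finset.mem_filter.1 hx).1 y (Finset.mem_filter.1 hy).1) rfl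
    have hmem : ∀ x ∈ S', x ∈ S ∧ a + m ≤ x := fun x hx => Finset.mem_filter.1 (hsub hx)
    have haS' : a ∉ S' := fun h => by have := (hmem a h).2; omega
    refine ⟨insert a S', ?_, ?_, ?_⟩
    · intro x hx
      rcases Finset.mem_insert.1 hx with rfl | hx
      · exact ha
      · exact (hmem x hx).1
    · have h1 : ((S.filter fun x => ¬ a + m ≤ x).erase a).card ≤ 1 := by
        rw [Finset.card_le_one]
        intro x hx y hy
        simp only [Finset.mem_erase, Finset.mem_filter] at hx hy
        have hax := hmin x hx.2.1
        have hay := hmin y hy.2.1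
        have h2 := hS a ha x hx.2.1 (by omega)
        have h3 := hS a ha y hy.2.1 (by omega)
        rcases lt_trichotomy x y with h | h | h
        · have := hS x hx.2.1 y hy.2.1 h
          omega
        · exact h
        · have := hS y hy.2.1 x hx.2.1 h
          omega
      have h2 := Finset.card_erase_add_one (s := S.filter fun x => ¬ a + m ≤ x) (a := a)
        (by simp [ha]; omega)
      have h3 := Finset.card_filter_add_card_filter_not (s := S) (fun x => a + m ≤ x)
      rw [Finset.card_insert_of_notMem haS']
      omega
    · intro x hx y hy hxy
      rcases Finset.mem_insert.1 hx with rfl | hx' <;>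
        rcases Finset.mem_insert.1 hy with rfl | hy'
      · omega
      · exact (hmem y hy').2
      · have := (hmem x hx').2
        omega
      · exact hgap x hx' y hy' hxy

namespace PeriodIndex

theorem report_eq (l : List (ℕ × ℕ)) : report l = (l, l.length + 1) := by
  induction l with
  | nil => rfl
  | cons x l ih => simp [report, ih]

/-- Records before `r` have smaller periods, so none of them stops the scan early. The periods are
strictly increasing integers, which bounds the number of records inspected; `b` is the lower bound
that grows along the induction. -/
theorem findPath_eq {m b : ℕ} {rs : List PathPtr} {r : PathPtr}
    (hs : rs.Pairwise fun r r' => r.period < r'.period) (hr : r ∈ rs)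
    (h1 : 2 * r.period < m) (h2 : m ≤ r.last)
    (huniq : ∀ r' ∈ rs, 2 * r'.period < m → m ≤ r'.last → r' = r)
    (hb : ∀ r' ∈ rs, b ≤ r'.period) :
    (findPath m rs).1 = some r ∧ (findPath m rs).2 + b ≤ r.period + 1 := by
  induction rs generalizing b with
  | nil => simp at hr
  | cons r₀ rs ih =>
    rw [List.pairwise_cons] at hs
    have hle : r₀.period ≤ r.period := by
      rcases List.mem_cons.1 hr with rfl | h
      · exact le_refl _
      · exact (hs.1 r h).le
    have hb0 := hb r₀ List.mem_cons_self
    have h3 : ¬ m ≤ 2 * r₀.period := by omega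
    by_cases h4 : m ≤ r₀.last
    · obtain rfl := huniq r₀ List.mem_cons_self (by omega) h4
      simp only [findPath, h3, h4, if_true, if_false]
      exact ⟨trivial, by omega⟩
    · have hr' : r ∈ rs := by
        rcases List.mem_cons.1 hr with rfl | h
        · exact absurd h2 h4
        · exact h
      have := ih (b := b + 1) hs.2 hr' (fun r' h => huniq r' (List.mem_cons_of_mem _ h))
        (fun r' h => by have := hs.1 r' h; omega)
      simp only [findPath, h3, h4, if_false]
      exact ⟨this.1, by omega⟩

end PeriodIndex

namespace IsPeriodIndexWith

variable {α : Type*} {T : List α} {M : PeriodIndex α} {periods : List (List α)}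

theorem getElem?_label {v : TreeNode α} {d : ℕ} (hd : d < v.depth) :
    (M.label v)[d]? = M.text[v.start + d]? := by
  rw [PeriodIndex.label, List.getElem?_take_of_lt hd, List.getElem?_drop]

/-- The invariant is that the matched prefix has `v` as its locus. A mismatch inside an edge is
final, since every node below the matched prefix extends the label of `v`; at the end of an edge the
dictionary leads to the next locus. -/
theorem walk_spec [DecidableEq α] (hM : IsPeriodIndexWith T M periods) (P : List α) :
    ∀ (v : TreeNode α) (d : ℕ), v ∈ M.nodes → d ≤ v.depth →
      IsLocus T ((M.label v).take d) (M.label v) →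
      (M.walk v d P).2 ≤ P.length + 1 ∧ ∀ u, (M.walk v d P).1 = some u ↔
        u ∈ M.nodes ∧ IsLocus T ((M.label v).take d ++ P.map some) (M.label u) := by
  induction P with
  | nil =>
    intro v d hv hd hl
    simp only [PeriodIndex.walk, List.map_nil, List.append_nil, Option.some_inj]
    refine ⟨by simp, fun u => ⟨?_, fun h => ?_⟩⟩
    · rintro rfl; exact ⟨hv, hl⟩
    · exact hM.eq_of_label_eq hv h.1 (hl.eq h.2)
  | cons c P ih =>
    intro v d hv hd hl
    have hlen := hM.length_label hv
    rw [PeriodIndex.walk, List.map_cons, List.append_cons]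
    rcases hd.lt_or_eq with hlt | heq
    · rw [if_pos hlt, ← getElem?_label hlt]
      by_cases hc : (M.label v)[d]? = some (some c)
      · rw [if_pos hc]
        have htake : (M.label v).take (d + 1) = (M.label v).take d ++ [some c] := by
          rw [List.take_add_one, hc]; rfl
        have h := ih v (d + 1) hv hlt (hl.of_isPrefix
          (List.take_prefix_take_left (by omega)) (List.take_prefix _ _))
        rw [htake] at h
        exact ⟨by simp; exact h.1, h.2⟩
      · rw [if_neg hc]
        refine ⟨by simp, fun u => ⟨by simp, fun h => absurd ?_ hc⟩⟩
        have h1 := hl.isPrefix h.2.1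
          (((List.prefix_append _ _).trans (List.prefix_append _ _)).trans h.2.2.1)
        have h2 := (List.prefix_append _ _).trans h.2.2.1
        have h3 := append_singleton_prefix_of_lt (w := (M.label v).take d) (c := some c) h2 h1
          (by simp; omega)
        have := (List.prefix_iff_getElem?.1 h3) d (by simp; omega)
        rw [this]
        simp [hlen, hd]
    · subst heq
      have htk : (M.label v).take v.depth = M.label v := by rw [← hlen, List.take_length]
      rw [if_neg (lt_irrefl _), htk]
      rcases hb : (v.children.lookup (some c)).bind (fun i => M.nodes[i]?) with _ | u
      · refine ⟨by simp, fun u => ⟨by simp, fun h => ?_⟩⟩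
        exfalso
        have hinf : M.label v ++ [some c] <:+: terminated T :=
          ((List.prefix_append _ _).trans h.2.2.1).isInfix.trans h.2.1.isInfix
        obtain ⟨w, hw⟩ := exists_isLocus hinf
        obtain ⟨u', hu', rfl⟩ := List.mem_map.1 ((hM.mem_nodes w).2 hw.1)
        obtain ⟨i, hi⟩ := List.mem_iff_getElem?.1 hu'
        have hmem := (hM.mem_children v hv (some c) i).2 ⟨u', hi, hw⟩
        rw [← lookup_eq_some_iff_mem (hM.keys_nodup v hv)] at hmem
        rw [hmem] at hb
        simp [hi] at hb
      · obtain ⟨i, hi, hu⟩ := Option.bind_eq_some_iff.1 hb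
        rw [lookup_eq_some_iff_mem (hM.keys_nodup v hv)] at hi
        obtain ⟨u', hu', hl'⟩ := (hM.mem_children v hv _ _).1 hi
        obtain rfl : u' = u := Option.some_injective _ (hu'.symm.trans hu)
        have hmem := List.mem_of_getElem? hu
        have hlu := hM.length_label hmem
        have hle := hl'.2.1.length_le
        simp only [List.length_append, List.length_singleton] at hle
        have htake : (M.label u').take (v.depth + 1) = M.label v ++ [some c] := by
          have := List.prefix_iff_eq_take.1 hl'.2.1
          rw [this]; simp [hlen]
        have h := ih u' (v.depth + 1) hmem (by omega) (by rw [htake]; exact hl')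
        rw [htake] at h
        exact ⟨by simp; exact h.1, h.2⟩

theorem walk_root [DecidableEq α] (hM : IsPeriodIndexWith T M periods) (P : List α) :
    ∃ root, M.nodes[0]? = some root ∧ (M.walk root 0 P).2 ≤ P.length + 1 ∧
      ∀ u, (M.walk root 0 P).1 = some u ↔
        u ∈ M.nodes ∧ IsLocus T (P.map some) (M.label u) := by
  obtain ⟨root, hr, hl⟩ := Option.map_eq_some_iff.1 hM.root
  have h := hM.walk_spec P root 0 (List.mem_of_getElem? hr) (Nat.zero_le _)
    (by rw [hl]; exact ⟨Or.inl rfl, List.nil_prefix, fun _ _ _ => Nat.zero_le _⟩)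
  exact ⟨root, hr, h⟩

end IsPeriodIndexWith

section Counting

variable {α : Type*} {T : List α}

theorem IsPeriodSequenceOf.occursAt {P : List α} {s e : ℕ} (h : IsPeriodSequenceOf T P s e) :
    OccursAt P T s := by
  obtain ⟨p, -, ⟨hse, he, -⟩, hP⟩ := h
  exact ⟨by omega, hP.trans (List.take_prefix _ _)⟩

/-- Different runs with the same period `p` share fewer than `p.length` positions. Since the first
one covers `P`, the second starts more than `P.length - p.length` later, which exceeds `P.length /
2`. -/
theorem IsPeriodSequenceOf.far {P : List α} (hP : IsPeriodic P) {s e s' e' : ℕ}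
    (h : IsPeriodSequenceOf T P s e) (h' : IsPeriodSequenceOf T P s' e') (hss : s ≤ s') :
    (s = s' ∧ e = e') ∨ P.length < 2 * (s' - s) := by
  obtain ⟨p, hp, hr, hPs⟩ := h
  obtain ⟨q, hq, hr', -⟩ := h'
  obtain ⟨r, hr1, hrc⟩ := hP.exists_continues
  obtain rfl := hp.eq hq
  obtain rfl := hp.eq hr1
  have h1 := (continues_iff.1 hrc).2.2.2
  have h2 := hPs.length_le
  rw [length_slice hr.2.1] at h2
  have h3 := hr'.isRun.len
  have h4 := hr.isRun.pos
  by_cases hle : s' + p.length ≤ e + 1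
  · exact Or.inl (hr.isRun.eq_of_overlap hr'.isRun hss (le_refl _) hle (by omega))
  · right; omega

theorem length_le_two_mul_occNO {P : List α} (hP : IsPeriodic P) {l : List (ℕ × ℕ)}
    (hl : l.Nodup) (h : ∀ x ∈ l, IsPeriodSequenceOf T P x.1 x.2) :
    l.length ≤ 2 * occNO T P := by
  have hpos : 0 < P.length := by
    obtain ⟨p, -, hc⟩ := hP.exists_continues
    have := (continues_iff.1 hc).2.2.2
    omega
  have hinj : ∀ x ∈ l, ∀ y ∈ l, x.1 = y.1 → x = y := by
    intro x hx y hy hxy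
    rcases (h x hx).far hP (h y hy) hxy.le with h1 | h1
    · exact Prod.ext h1.1 h1.2
    · omega
  have hnd : (l.map Prod.fst).Nodup := hl.map_on hinj
  obtain ⟨S', hsub, hcard, hgap⟩ := exists_subset_of_gaps hpos (l.map Prod.fst).toFinset (by
    intro a ha b hb hab
    rw [List.mem_toFinset] at ha hb
    obtain ⟨x, hx, rfl⟩ := List.mem_map.1 ha
    obtain ⟨y, hy, rfl⟩ := List.mem_map.1 hb
    rcases (h x hx).far hP (h y hy) hab.le with h1 | h1
    · omega
    · exact h1)
  rw [List.toFinset_card_of_nodup hnd, List.length_map] at hcard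
  have hocc : ∀ i ∈ S', OccursAt P T i := by
    intro i hi
    obtain ⟨x, hx, rfl⟩ := List.mem_map.1 (List.mem_toFinset.1 (hsub hi))
    exact (h x hx).occursAt
  refine hcard.trans (Nat.mul_le_mul_left 2 ?_)
  unfold occNO
  refine Finset.le_sup (f := Finset.card) ?_
  simp only [Finset.mem_filter, Finset.mem_powerset]
  refine ⟨fun i hi => ?_, hocc, hgap⟩
  have := (hocc i hi).1
  exact Finset.mem_range.2 (by omega)

end Counting

namespace IsPeriodIndexWith

variable {α : Type*} {T : List α} {M : PeriodIndex α} {periods : List (List α)}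

theorem exists_path (hM : IsPeriodIndexWith T M periods) {p P : List α} {v : TreeNode α}
    (hv : v ∈ M.nodes) (hp : IsPathPeriod T p) (hc : Continues p P)
    (hl : IsLocus T (P.map some) (M.label v)) :
    ∃ r ∈ v.paths, r.period = p.length ∧ P.length ≤ r.last ∧ periods[r.list]? = some p := by
  obtain ⟨i, L, hi, hL⟩ := hM.exists_list hp
  let S := {m | ∃ P : List α, P.length = m ∧ Continues p P ∧
        IsLocus T (P.map some) (M.label v)}
  have hS : BddAbove S := ⟨(M.label v).length, by
    rintro _ ⟨Q, rfl, -, hQ⟩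
    simpa using hQ.2.1.length_le⟩
  have hmem : P.length ∈ S := ⟨P, rfl, hc, hl⟩
  have hgr : IsGreatest S (sSup S) := ⟨Nat.sSup_mem ⟨_, hmem⟩ hS, fun x hx => le_csSup hS hx⟩
  exact ⟨⟨p.length, sSup S, i, L.countP fun x => decide (x.2 + 1 - x.1 < sSup S)⟩, (hM.mem_paths v hv _).2
    ⟨p, L, hi, hL, ⟨P, hc, hl⟩, rfl, hgr, rfl⟩, rfl, le_csSup hS hmem, hi⟩

/-- This is why the pointer may compare lengths with `last` rather than with `P.length`: no period
sequence of `P` has a length in between. -/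
theorem mem_list_iff (hM : IsPeriodIndexWith T M periods) {p P : List α} {v : TreeNode α}
    (hv : v ∈ M.nodes) (hpP : IsShortestPeriod p P) (hc : Continues p P)
    (hl : IsLocus T (P.map some) (M.label v)) {r : PathPtr} (hr : r ∈ v.paths)
    (hrp : periods[r.list]? = some p) (hPr : P.length ≤ r.last) {L : List (ℕ × ℕ)}
    (hL : M.lists[r.list]? = some L) (s e : ℕ) :
    (s, e) ∈ L ∧ r.last ≤ e + 1 - s ↔ IsPeriodSequenceOf T P s e := by
  rw [hM.mem_lists _ _ _ hrp hL]
  have hp := hpP.isPrimitive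
  constructor
  · rintro ⟨⟨⟨q, hq⟩, hb⟩, hle⟩
    have hlen := length_slice (s := s) hq.2.1
    have hqc : Continues q (slice T s e) :=
      ⟨hq.2.2.1.1, hq.2.2.1.2.1, by rw [hlen]; exact hq.2.2.2.1⟩
    obtain rfl := hp.eq_of_continues hq.2.2.1.isPrimitive hb.2 hqc
    exact ⟨p, hpP, hq, hc.prefix_of_length_le hb.2 (by omega)⟩
  · intro h
    have hocc := h.occursAt
    obtain ⟨q, hqP, hq, hP⟩ := h
    obtain rfl := hpP.eq hqP
    have hlen := length_slice (s := s) hq.2.1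
    have hqc : Continues p (slice T s e) :=
      ⟨hq.2.2.1.1, hq.2.2.1.2.1, by rw [hlen]; exact hq.2.2.2.1⟩
    refine ⟨⟨⟨p, hq⟩, (hM.mem_periods p).1 (List.mem_of_getElem? hrp), hqc⟩, ?_⟩
    -- An occurrence of `P` at `s` extends to the label of `v`, hence to the word `Q` of length
    -- `last` with the same period. A shorter period sequence could be prolonged along `Q`.
    by_contra hcon
    obtain ⟨p', Q, hp', -, -, hQl, hQc, hQ⟩ := hM.exists_of_mem_paths hv hr
    obtain rfl : p = p' := Option.some_injective _ (hrp.symm.trans hp')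
    have h1 := hl.occursAt hocc.map_some_terminated
    have hQne : Q ≠ [] := by
      rintro rfl
      have := (continues_iff.1 hQc).2.2.2
      simp at this
    have h2 : OccursAt Q T s :=
      (occursAt_map_some_terminated_iff hQne).1 ⟨h1.1, hQ.2.1.trans h1.2⟩
    have hper := hasPeriod_iff.1 (continues_iff.1 hQc).2.2.1
    have h3 := hq.1
    have := (hq.isRun.maximal s (s + r.last - 1) (le_refl _) (by omega) (by
      intro x hx hxe
      obtain ⟨x, rfl⟩ := Nat.exists_eq_add_of_le hx
      have h4 := hper x (by omega)
      rw [← h2.getElem? (by omega), ← h2.getElem? (by omega), ← add_assoc] at h4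
      exact h4)).2
    omega

theorem query_spec [DecidableEq α] (hM : IsPeriodIndexWith T M periods) {P : List α}
    (hP : IsPeriodic P) :
    (M.query P).1.Nodup ∧
      (∀ s e : ℕ, (s, e) ∈ (M.query P).1 ↔ IsPeriodSequenceOf T P s e) ∧
      (M.query P).2 ≤ 5 * (P.length + occNO T P) := by
  obtain ⟨p, hpP, hc⟩ := hP.exists_continues
  have hm := (continues_iff.1 hc).2.2.2
  have hPne : P ≠ [] := by rintro rfl; simp at hm
  obtain ⟨root, hroot, hsteps, hwalk⟩ := hM.walk_root P
  unfold PeriodIndex.query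
  simp only [hroot]
  rcases hw : M.walk root 0 P with ⟨_ | v, t₁⟩
  · rw [hw] at hwalk hsteps
    simp only
    refine ⟨by simp, fun s e => ?_, ?_⟩
    · simp only [List.not_mem_nil, false_iff]
      intro h
      obtain ⟨w, hw⟩ := exists_isLocus
        (isInfix_iff_occursAt.2 ⟨s, h.occursAt.map_some_terminated⟩)
      obtain ⟨u, hu, rfl⟩ := List.mem_map.1 ((hM.mem_nodes w).2 hw.1)
      exact absurd ((hwalk u).2 ⟨hu, hw⟩) (by simp)
    · simp only at hsteps
      omega
  · rw [hw] at hwalk hsteps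
    obtain ⟨hv, hl⟩ := (hwalk v).1 rfl
    have hPT : P <:+: T :=
      (map_some_isInfix_terminated_iff hPne).1 (hl.2.1.isInfix.trans hl.1.isInfix)
    have hpath : IsPathPeriod T p := isPathPeriod_iff.2 ⟨hpP.isPrimitive, P, hPT, hc⟩
    obtain ⟨r, hr, hrp, hPr, hrl⟩ := hM.exists_path hv hpath hc hl
    -- A record passing both tests belongs to a path containing `P` itself, and `P` lies on one path
    -- only.
    have huniq : ∀ r' ∈ v.paths, 2 * r'.period < P.length → P.length ≤ r'.last → r' = r := by
      intro r' hr' h1 h2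
      obtain ⟨q, Q, hq, hqp, hql, hQl, hQc, hQ⟩ := hM.exists_of_mem_paths hv hr'
      have hPQ : P <+: Q := isPrefix_map_some_iff.1
        (List.prefix_of_prefix_length_le hl.2.1 hQ.2.1 (by simp; omega))
      obtain rfl := hpP.isPrimitive.eq_of_continues hqp hc (hQc.of_prefix hPQ (by omega))
      exact hM.paths_eq_of_list_eq hv hr' hr (getElem?_injective_of_nodup hM.periods_nodup hq hrl)
    obtain ⟨hf1, hf2⟩ := PeriodIndex.findPath_eq (b := 0) (hM.paths_sorted v hv) hr
      (m := P.length) (by omega) hPr huniq (fun _ _ => Nat.zero_le _)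
    rcases hfp : PeriodIndex.findPath P.length v.paths with ⟨o, t₂⟩
    rw [hfp] at hf1 hf2
    obtain rfl : o = some r := hf1
    obtain ⟨q, L, hq, hL, -, -, -, ho⟩ := (hM.mem_paths v hv r).1 hr
    have hgetD : M.lists.getD r.list [] = L := by
      rw [List.getD_eq_getElem?_getD, hL]; rfl
    have hLmem := List.mem_of_getElem? hL
    have hnd : (L.drop r.offset).Nodup :=
      (hM.lists_nodup L hLmem).sublist (List.drop_sublist _ _)
    have hspec : ∀ s e : ℕ, (s, e) ∈ L.drop r.offset ↔ IsPeriodSequenceOf T P s e := by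
      intro s e
      rw [ho, mem_drop_countP_iff (f := fun x : ℕ × ℕ => x.2 + 1 - x.1) (hM.lists_sorted L hLmem)]
      exact hM.mem_list_iff hv hpP hc hl hr hrl hPr hL s e
    have hcount := length_le_two_mul_occNO hP hnd fun x hx => (hspec x.1 x.2).1 hx
    simp only [hfp, hgetD, PeriodIndex.report_eq]
    refine ⟨hnd, hspec, ?_⟩
    simp only at hsteps hf2
    omega

end IsPeriodIndexWith
end Query

/-! ### Construction of the data structure -/

section Existence

theorem exists_sorted_list {γ : Type*} {S : Set γ} (hS : S.Finite) (f : γ → ℕ) :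
    ∃ l : List γ, l.Nodup ∧ (∀ x, x ∈ l ↔ x ∈ S) ∧ l.Pairwise fun x y => f x ≤ f y := by
  classical
  refine ⟨hS.toFinset.toList.mergeSort (fun x y => decide (f x ≤ f y)), ?_, fun x => ?_, ?_⟩
  · exact (List.mergeSort_perm _ _).nodup_iff.2 (Finset.nodup_toList _)
  · rw [List.mem_mergeSort]; simp
  · have := List.pairwise_mergeSort (le := fun x y : γ => decide (f x ≤ f y))
      (fun a b c h1 h2 => by simp at *; omega) (fun a b => by simp; omega) hS.toFinset.toList
    exact this.imp fun h => by simpa using h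

variable {α : Type*}

/-- The records of the node with label `w`, given the periods of the paths and their lists. -/
def pathRecords (T : List α) (periods : List (List α)) (lists : List (List (ℕ × ℕ)))
    (w : List (Option α)) : Set PathPtr :=
  {r | ∃ p L, periods[r.list]? = some p ∧ lists[r.list]? = some L ∧
      w ∈ periodPath T p ∧ r.period = p.length ∧
      IsGreatest {m | ∃ P : List α, P.length = m ∧ Continues p P ∧
        IsLocus T (P.map some) w} r.last ∧
      r.offset = L.countP fun x => decide (x.2 + 1 - x.1 < r.last)}

theorem pathRecords_injOn_list (T : List α) (periods : List (List α))
    (lists : List (List (ℕ × ℕ))) (w : List (Option α)) :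
    Set.InjOn PathPtr.list (pathRecords T periods lists w) := by
  rintro r ⟨p, L, hp, hL, -, h1, h2, h3⟩ r' ⟨p', L', hp', hL', -, h1', h2', h3'⟩ h
  rw [← h] at hp' hL'
  obtain rfl : p = p' := Option.some_injective _ (hp.symm.trans hp')
  obtain rfl : L = L' := Option.some_injective _ (hL.symm.trans hL')
  have hlast := h2.unique h2'
  cases r; cases r'
  simp_all

theorem pathRecords_finite (T : List α) (periods : List (List α))
    (lists : List (List (ℕ × ℕ))) (w : List (Option α)) :
    (pathRecords T periods lists w).Finite := by
  refine Set.Finite.of_finite_image (f := PathPtr.list)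
    ((Finset.range periods.length).finite_toSet.subset ?_) (pathRecords_injOn_list T periods lists w)
  rintro _ ⟨r, ⟨p, L, hp, -⟩, rfl⟩
  simpa using (List.getElem?_eq_some_iff.1 hp).1

/-- All periods of paths through a node are prefixes of its label, so equal lengths mean equal
periods. This turns the sorted order of the records into a strict one. -/
theorem pathRecords_injOn_period (T : List α) {periods : List (List α)} (hnd : periods.Nodup)
    (lists : List (List (ℕ × ℕ))) (w : List (Option α)) :
    Set.InjOn PathPtr.period (pathRecords T periods lists w) := by
  intro r hr r' hr' h
  refine pathRecords_injOn_list T periods lists w hr hr' ?_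
  obtain ⟨p, L, hp, -, ⟨P, hPc, hP⟩, h1, -⟩ := hr
  obtain ⟨p', L', hp', -, ⟨P', hPc', hP'⟩, h1', -⟩ := hr'
  have h2 := (isPrefix_map_some_iff.2 (continues_iff.1 hPc).2.1).trans hP.2.1
  have h3 := (isPrefix_map_some_iff.2 (continues_iff.1 hPc').2.1).trans hP'.2.1
  have h4 : p.length = p'.length := by omega
  have h5 := isPrefix_map_some_iff.1 (List.prefix_of_prefix_length_le h2 h3 (by simp [h4]))
  obtain rfl := h5.eq_of_length h4
  exact getElem?_injective_of_nodup hnd hp hp'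

theorem exists_isPeriodIndex (T : List α) : ∃ M : PeriodIndex α, IsPeriodIndex T M := by
  classical
  -- The constant key means that only an enumeration is wanted; the root is moved to the front
  -- afterwards.
  obtain ⟨W₀, hW₀, hmemW₀, -⟩ := exists_sorted_list
    (Set.finite_of_encard_le_coe (encard_isTreeNode_le T)) fun _ => 0
  obtain ⟨W, hW, hmemW, hroot⟩ : ∃ W : List (List (Option α)), W.Nodup ∧
      (∀ w, w ∈ W ↔ IsTreeNode T w) ∧ W[0]? = some [] := by
    refine ⟨[] :: W₀.filter (fun w => decide (w ≠ [])), ?_, fun w => ?_, rfl⟩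
    · rw [List.nodup_cons]
      exact ⟨by simp, hW₀.filter _⟩
    · rw [List.mem_cons, List.mem_filter, hmemW₀]
      by_cases hw : w = []
      · simp [hw, IsTreeNode]
      · simp [hw]
  obtain ⟨periods, hper, hmemper, -⟩ := exists_sorted_list
    (Set.finite_of_encard_le_coe (encard_isPathPeriod_le T)) fun _ => 0
  have hlists : ∀ p : List α, ∃ L : List (ℕ × ℕ), L.Nodup ∧
      (∀ x, x ∈ L ↔ x ∈ {x : ℕ × ℕ | IsPeriodSequence T x.1 x.2 ∧ BelongsToPath T p x.1 x.2}) ∧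
      L.Pairwise fun x y => x.2 + 1 - x.1 ≤ y.2 + 1 - y.1 := fun p =>
    exists_sorted_list ((Set.finite_of_encard_le_coe (encard_periodSequences_le T)).subset
      fun x hx => hx.1) fun x => x.2 + 1 - x.1
  choose listOf hlnd hlmem hlsorted using hlists
  have hstart : ∀ w : List (Option α), ∃ i, IsTreeNode T w → OccursAt w (terminated T) i := by
    intro w
    by_cases hw : IsTreeNode T w
    · obtain ⟨i, hi⟩ := isInfix_iff_occursAt.1 hw.isInfix
      exact ⟨i, fun _ => hi⟩
    · exact ⟨0, fun h => absurd h hw⟩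
  choose start hstart using hstart
  have hchildren : ∀ w : List (Option α), ∃ l : List (Option α × ℕ), l.Nodup ∧
      (∀ x, x ∈ l ↔ x ∈ {x : Option α × ℕ | ∃ u, W[x.2]? = some u ∧ IsLocus T (w ++ [x.1]) u}) ∧
      l.Pairwise fun x y => x.2 ≤ y.2 := by
    intro w
    refine exists_sorted_list (Set.Finite.subset
      ((terminated T).toFinset ×ˢ Finset.range W.length).finite_toSet ?_) _
    rintro ⟨c, i⟩ ⟨u, hu, hl⟩
    have h1 : c ∈ terminated T := (hl.2.1.isInfix.trans hl.1.isInfix).subset (by simp)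
    simpa using ⟨h1, (List.getElem?_eq_some_iff.1 hu).1⟩
  choose children hcnd hcmem hcsorted using hchildren
  have hpaths := fun w => exists_sorted_list
    (pathRecords_finite T periods (periods.map listOf) w) PathPtr.period
  choose paths hpnd hpmem hpsorted using hpaths
  let mk : List (Option α) → TreeNode α := fun w => ⟨start w, w.length, children w, paths w⟩
  let M : PeriodIndex α := ⟨terminated T, W.map mk, periods.map listOf⟩
  have hlabel : ∀ w ∈ W, M.label (mk w) = w := by
    intro w hw
    exact (List.prefix_iff_eq_take.1 (hstart w ((hmemW w).1 hw)).2).symm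
  have hlabels : M.nodes.map M.label = W := by
    change (W.map mk).map M.label = W
    rw [List.map_map]
    conv_rhs => rw [← List.map_id W]
    exact List.map_congr_left hlabel
  have hnode : ∀ v ∈ M.nodes, ∃ w ∈ W, mk w = v := fun v hv => List.mem_map.1 hv
  have hget : ∀ (i : ℕ) (X : List (Option α)),
      (∃ u, M.nodes[i]? = some u ∧ IsLocus T X (M.label u)) ↔
        ∃ w, W[i]? = some w ∧ IsLocus T X w := by
    intro i X
    conv_rhs => rw [← hlabels]
    simp [List.getElem?_map]
  have hlistget : ∀ {i : ℕ} {p : List α} {L : List (ℕ × ℕ)}, periods[i]? = some p →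
      M.lists[i]? = some L → L = listOf p := by
    intro i p L hp hL
    change (periods.map listOf)[i]? = some L at hL
    rw [List.getElem?_map, hp] at hL
    exact (Option.some_injective _ hL).symm
  refine ⟨M, periods, ?_⟩
  constructor
  · rfl
  · rw [← List.getElem?_map, hlabels, hroot]
  · rw [hlabels]; exact hW
  · rw [hlabels]; exact hmemW
  · intro v hv
    obtain ⟨w, hw, rfl⟩ := hnode v hv
    exact (hstart w ((hmemW w).1 hw)).add_length_le
  · intro v hv
    obtain ⟨w, hw, rfl⟩ := hnode v hv
    refine (hcnd w).map_on ?_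
    rintro ⟨c, i⟩ h ⟨c', i'⟩ h' hcc
    obtain rfl : c = c' := hcc
    obtain ⟨u, hu, hl⟩ := (hcmem w _).1 h
    obtain ⟨u', hu', hl'⟩ := (hcmem w _).1 h'
    obtain rfl := hl.eq hl'
    exact Prod.ext rfl (getElem?_injective_of_nodup hW hu hu')
  · intro v hv c i
    obtain ⟨w, hw, rfl⟩ := hnode v hv
    rw [hlabel w hw, hget]
    exact hcmem w (c, i)
  · exact hper
  · exact hmemper
  · exact List.length_map _
  · intro L hL
    obtain ⟨p, -, rfl⟩ := List.mem_map.1 hL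
    exact hlnd p
  · intro L hL
    obtain ⟨p, -, rfl⟩ := List.mem_map.1 hL
    exact hlsorted p
  · intro i p L hp hL s e
    rw [hlistget hp hL]
    exact hlmem p (s, e)
  · intro v hv
    obtain ⟨w, hw, rfl⟩ := hnode v hv
    refine ((hpsorted w).and (hpnd w)).imp_of_mem ?_
    rintro r r' hr hr' ⟨h1, h2⟩
    refine lt_of_le_of_ne h1 fun h => h2 ?_
    exact pathRecords_injOn_period T hper _ w ((hpmem w r).1 hr) ((hpmem w r').1 hr') h
  · intro v hv r
    obtain ⟨w, hw, rfl⟩ := hnode v hv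
    rw [hlabel w hw]
    exact hpmem w r

end Existence
end PeriodPaths

open PeriodPaths
theorem mainTheorem5 :
    ∃ C : ℕ, ∀ (α : Type*) [DecidableEq α] (T : List α), T ≠ [] →
      -- each period sequence belongs to exactly one period path
      (∀ s e : ℕ, IsPeriodSequence T s e → ∃! p : List α, BelongsToPath T p s e) ∧
      -- there are `O(n)` period sequences
      {x : ℕ × ℕ | IsPeriodSequence T x.1 x.2}.encard ≤ ((C * T.length : ℕ) : ℕ∞) ∧
      -- the data structure exists
      (∃ M : PeriodIndex α, IsPeriodIndex T M) ∧
      ∀ M : PeriodIndex α, IsPeriodIndex T M →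
        -- it takes `O(n)` words, of `log n + O(1)` bits each
        M.space ≤ C * T.length ∧
        (∀ k ∈ M.numbers, k ≤ C * T.length) ∧
        -- a query for a periodic pattern retrieves all its period sequences, in time `O(m + occ_NO)`
        ∀ P : List α, IsPeriodic P →
          (M.query P).1.Nodup ∧
          (∀ s e : ℕ, (s, e) ∈ (M.query P).1 ↔ IsPeriodSequenceOf T P s e) ∧
          (M.query P).2 ≤ C * (P.length + occNO T P) := by
  -- The space bound `33 * n + 34` is at most `67 * n` because `n ≥ 1`; the other bounds are
  -- smaller.
  refine ⟨67, fun α _ T hT => ?_⟩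
  have hn : 0 < T.length := List.length_pos_of_ne_nil hT
  refine ⟨fun s e h => h.existsUnique_path, ?_, exists_isPeriodIndex T, ?_⟩
  · exact (encard_periodSequences_le T).trans (Nat.cast_le.2 (by omega))
  · rintro M ⟨periods, hM⟩
    refine ⟨hM.space_le.trans (by omega), fun k hk => (hM.le_of_mem_numbers hk).trans (by omega),
      fun P hP => ?_⟩
    obtain ⟨h1, h2, h3⟩ := hM.query_spec hP
    exact ⟨h1, h2, h3.trans (Nat.mul_le_mul_right _ (by norm_num))⟩
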